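/- Let $p,q\ge 0$ be integers, let $J\subset\mathbb R$ be an open interval, and let $\gamma=(x,y):J\to\mathbb R^2$ be a smooth curve with $\dot x^2+\dot y^2=1$. Let $\alpha:J\to\mathbb R$ be a smooth function with $\dot x=\cos\alpha$, $\dot y=\sin\alpha$ (the angle of $\gamma$ with the $x$-axis). For an immersion $\varphi:M\to\mathbb R^n$, where $M$ carries the induced metric, let $\tau(\varphi)=\operatorname{trace}\nabla d\varphi$ be the tension field and $\tau_2(\varphi)=-\Delta\tau(\varphi)$ the bitension field, where $\Delta=-\sum_i(\nabla^\varphi_{e_i}\nabla^\varphi_{e_i}-\nabla^\varphi_{\nabla^M_{e_i}e_i})$ is the rough Laplacian (the curvature term of $\tau_2$ vanishes, as $\mathbb R^n$ is flat). The shape operator $A$ with respect to a unit normal field $\eta$ is defined by $\nabla^\varphi_X\eta=-d\varphi(A X)$. (i) Assume $x>0$ and $y>0$ on $J$, and let $$\varphi:\mathbb S^p\times\mathbb S^q\times J\to\mathbb R^{p+1}\times\mathbb R^{q+1},\qquad \varphi(w,z,s)=(x(s)w,\,y(s)z).$$ Then $\varphi$ is an immersion with unit normal field $\eta=(-\dot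 y\,w,\dot x\,z)$. Its shape operator with respect to $\eta$ is $\frac{\dot y}{x}\,\mathrm{Id}$ on $T\mathbb S^p$, $-\frac{\dot x}{y}\,\mathrm{Id}$ on $T\mathbb S^q$, and $\dot\alpha\,\mathrm{Id}$ on $\mathbb R\,\partial_s$; so at each point its matrix in a suitable orthonormal basis is diagonal, with entries $\frac{\dot y}{x}$ ($p$ times), $-\frac{\dot x}{y}$ ($q$ times) and $\dot\alpha$. Put $$f=\dot\alpha+p\,\frac{\sin\alpha}{x}-q\,\frac{\cos\alpha}{y}.$$ At each point $(w,z,s)$, the part of $\tau_2(\varphi)$ tangential to $\varphi$ vanishes if and only if $$\dot f\,(f+2\dot\alpha)=0\quad\text{at } s,$$ and the part of $\tau_2(\varphi)$ normal to $\varphi$ vanishes if and only if $$\ddot f+\dot f\Big(p\,\frac{\dot x}{x}+q\,\frac{\dot y}{y}\Big)-f\Big(p\Big(\frac{\dot y}{x}\Big)^2+q\Big(\frac{\dot x}{y}\Big)^2+\dot\alpha^2\Big)=0\quad\text{at } s.$$ (ii) Assume only $x>0$ on $J$, and let $$\varphi:\mathbb S^p\times J\to\mathbb R^{p+1}\times\mathbb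 R,\qquad \varphi(w,s)=(x(s)w,\,y(s)).$$ Then $\varphi$ is an immersion with unit normal field $\eta=(-\dot y\,w,\dot x)$. Its shape operator with respect to $\eta$ is $\frac{\dot y}{x}\,\mathrm{Id}$ on $T\mathbb S^p$ and $\dot\alpha\,\mathrm{Id}$ on $\mathbb R\,\partial_s$; so at each point its matrix in a suitable orthonormal basis is diagonal, with entries $\frac{\dot y}{x}$ ($p$ times) and $\dot\alpha$. Put $f=\dot\alpha+p\,\frac{\dot y}{x}$. At each point $(w,s)$, the tangential part of $\tau_2(\varphi)$ vanishes if and only if $\dot f\,(f+2\dot\alpha)=0$ at $s$, and the normal part of $\tau_2(\varphi)$ vanishes if and only if $$\ddot f+p\,\dot f\,\frac{\dot x}{x}-f\Big(p\Big(\frac{\dot y}{x}\Big)^2+\dot\alpha^2\Big)=0\quad\text{at } s.$$ -/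

import Mathlib

open scoped Manifold ContDiff

noncomputable section

namespace Biharmonic

/-! ### Tension and bitension field of an immersion into a Euclidean space

Throughout, `M` is a manifold without boundary modelled (through `I`) on the finite-dimensional space `V`, `E` is a
Euclidean space, `φ : M → E` is a smooth immersion, and `M` carries the induced Riemannian metric.
Objects on `M` are computed at `m` in the chart of `M` at `m`, with respect to a basis of `V`. -/

section LocalCoordinates

variable {V : Type*} [NormedAddCommGroup V] [NormedSpace ℝ V]
  {E : Type*} [NormedAddCommGroup E] [InnerProductSpace ℝ E]
  {F : Type*} [NormedAddCommGroup F] [NormedSpace ℝ F]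
  {ι : Type*} [Fintype ι] [DecidableEq ι]

/-- The coordinate partial derivative `∂ᵢ v`. -/
def pd (b : Module.Basis ι ℝ V) (i : ι) (v : V → F) (ξ : V) : F :=
  fderiv ℝ v ξ (b i)

/-- The induced metric `gᵢⱼ = ⟨∂ᵢ u, ∂ⱼ u⟩` of a local parametrization `u`. -/
def metricMatrix (b : Module.Basis ι ℝ V) (u : V → E) (ξ : V) : Matrix ι ι ℝ :=
  Matrix.of fun i j => inner ℝ (pd b i u ξ) (pd b j u ξ)

/-- The Christoffel symbols
`Γᵏᵢⱼ = ½ ∑ₗ gᵏˡ (∂ᵢ gⱼₗ + ∂ⱼ gᵢₗ - ∂ₗ gᵢⱼ)` of a metric `g` given in coordinates. -/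
def christoffel (b : Module.Basis ι ℝ V) (g : V → Matrix ι ι ℝ) (k i j : ι) (ξ : V) : ℝ :=
  (1 / 2) * ∑ l, (g ξ)⁻¹ k l *
    (pd b i (fun ζ => g ζ j l) ξ + pd b j (fun ζ => g ζ i l) ξ - pd b l (fun ζ => g ζ i j) ξ)

/-- The trace of the second covariant derivative in coordinates,
`∑ᵢⱼ gⁱʲ (∂ᵢ ∂ⱼ v - ∑ₖ Γᵏᵢⱼ ∂ₖ v)`, of a map `v` with values in a vector space. -/
def traceHessian (b : Module.Basis ι ℝ V) (g : V → Matrix ι ι ℝ) (v : V → F) (ξ : V) : F :=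
  ∑ i, ∑ j, (g ξ)⁻¹ i j •
    (pd b i (fun ζ => pd b j v ζ) ξ - ∑ k, christoffel b g k i j ξ • pd b k v ξ)

end LocalCoordinates

section Immersions

variable {V : Type*} [NormedAddCommGroup V] [NormedSpace ℝ V] [FiniteDimensional ℝ V]
  {H : Type*} [TopologicalSpace H] (I : ModelWithCorners ℝ V H)
  {M : Type*} [TopologicalSpace M] [ChartedSpace H M]
  {E : Type*} [NormedAddCommGroup E] [InnerProductSpace ℝ E]

/-- `trace ∇d v` at `m`, for `v : M → E`, where `M` has the metric induced by `φ : M → E` and its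
Levi-Civita connection, and `E` has its flat connection. -/
def traceSecondDerivative (φ v : M → E) (m : M) : E :=
  traceHessian (Module.finBasis ℝ V)
    (metricMatrix (Module.finBasis ℝ V) (φ ∘ (extChartAt I m).symm))
    (v ∘ (extChartAt I m).symm) (extChartAt I m m)

/-- The tension field `τ(φ) = trace ∇dφ`. -/
def tension (φ : M → E) (m : M) : E :=
  traceSecondDerivative I φ φ m

/-- The rough Laplacian `Δ = -∑ᵢ (∇_{eᵢ} ∇_{eᵢ} - ∇_{∇_{eᵢ} eᵢ})` (with this sign) on sections of
the pull-back bundle `φ⁻¹ TE`, that is, on maps `M → E`, the pull-back connection being flat. -/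
def roughLaplacian (φ v : M → E) (m : M) : E :=
  -traceSecondDerivative I φ v m

/-- The bitension field `τ₂(φ) = -Δ τ(φ) - trace R(dφ, τ(φ)) dφ`; the curvature `R` of the
Euclidean space `E` is zero. -/
def bitension (φ : M → E) (m : M) : E :=
  -roughLaplacian I φ (tension I φ) m

/-- `η` is a unit normal field of `φ` at `m`. -/
def IsUnitNormalAt (φ η : M → E) (m : M) : Prop :=
  ‖η m‖ = 1 ∧ ∀ X : TangentSpace I m, inner ℝ (η m) (mvfderiv I φ m X) = 0

/-- `A` is the shape operator of the hypersurface `φ` at `m` with respect to the unit normal field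
`η`: Weingarten's equation `∇_X η = -dφ(A X)` holds. -/
def IsShapeOperatorAt (φ η : M → E) (m : M)
    (A : TangentSpace I m →ₗ[ℝ] TangentSpace I m) : Prop :=
  ∀ X : TangentSpace I m, mvfderiv I η m X = -mvfderiv I φ m (A X)

/-- A basis of `T_m M` is orthonormal for the metric induced by `φ`. -/
def IsOrthonormalFrameAt {κ : Type*} (φ : M → E) (m : M)
    (e : Module.Basis κ ℝ (TangentSpace I m)) : Prop :=
  Orthonormal ℝ fun k => mvfderiv I φ m (e k)

variable [FiniteDimensional ℝ E]

/-- The part of `v`, a vector of `E` at the point `φ m`, tangential to `φ`. -/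
def tangentialPart (φ : M → E) (m : M) (v : E) : E :=
  (LinearMap.range (mvfderiv I φ m).toLinearMap).starProjection v

/-- The part of `v`, a vector of `E` at the point `φ m`, normal to `φ`. -/
def normalPart (φ : M → E) (m : M) (v : E) : E :=
  (LinearMap.range (mvfderiv I φ m).toLinearMap)ᗮ.starProjection v

end Immersions

/-! ### The equivariant immersions -/

/-- The unit sphere `𝕊ⁿ` of `ℝⁿ⁺¹`. -/
abbrev Sph (n : ℕ) : Type :=
  Metric.sphere (0 : EuclideanSpace ℝ (Fin (n + 1))) 1

instance factFinrank (n : ℕ) : Fact (Module.finrank ℝ (EuclideanSpace ℝ (Fin (n + 1))) = n + 1) :=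
  ⟨by simp⟩

/-- `γ = (x, y)` is a smooth arc-length curve on the interval `J`, and the smooth function `α` is
the angle that it forms with the `x`-axis. -/
structure IsProfile (J : TopologicalSpace.Opens ℝ) (x y α : ℝ → ℝ) : Prop where
  ordConnected : (J : Set ℝ).OrdConnected
  smooth_x : ContDiffOn ℝ ∞ x J
  smooth_y : ContDiffOn ℝ ∞ y J
  arc_length : ∀ s ∈ J, deriv x s ^ 2 + deriv y s ^ 2 = 1
  smooth_angle : ContDiffOn ℝ ∞ α J
  cos_angle : ∀ s ∈ J, deriv x s = Real.cos (α s)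
  sin_angle : ∀ s ∈ J, deriv y s = Real.sin (α s)

section Two

/-- The model of `𝕊ᵖ × 𝕊^q × J`; its tangent spaces are `T𝕊ᵖ × T𝕊^q × ℝ`. -/
abbrev Model (p q : ℕ) := (𝓡 p).prod ((𝓡 q).prod 𝓘(ℝ, ℝ))

/-- The immersion `(w, z, s) ↦ (x(s) w, y(s) z)` of `𝕊ᵖ × 𝕊^q × J` into `ℝᵖ⁺¹ × ℝ^{q+1}`. -/
def imm (p q : ℕ) (J : TopologicalSpace.Opens ℝ) (x y : ℝ → ℝ) (m : Sph p × Sph q × J) :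
    WithLp 2 (EuclideanSpace ℝ (Fin (p + 1)) × EuclideanSpace ℝ (Fin (q + 1))) :=
  WithLp.toLp 2 (x m.2.2 • (m.1 : EuclideanSpace ℝ (Fin (p + 1))),
    y m.2.2 • (m.2.1 : EuclideanSpace ℝ (Fin (q + 1))))

/-- The unit normal `η = (-ẏ w, ẋ z)`. -/
def immNormal (p q : ℕ) (J : TopologicalSpace.Opens ℝ) (x y : ℝ → ℝ) :
    Sph p × Sph q × J →
      WithLp 2 (EuclideanSpace ℝ (Fin (p + 1)) × EuclideanSpace ℝ (Fin (q + 1))) :=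
  imm p q J (fun s => -deriv y s) (deriv x)

/-- `f = α̇ + p sin α / x - q cos α / y`. -/
def meanCurv (p q : ℕ) (x y α : ℝ → ℝ) (s : ℝ) : ℝ :=
  deriv α s + p * (Real.sin (α s) / x s) - q * (Real.cos (α s) / y s)

end Two

section One

/-- The model of `𝕊ᵖ × J`; its tangent spaces are `T𝕊ᵖ × ℝ`. -/
abbrev ModelOne (p : ℕ) := (𝓡 p).prod 𝓘(ℝ, ℝ)

/-- The immersion `(w, s) ↦ (x(s) w, y(s))` of `𝕊ᵖ × J` into `ℝᵖ⁺¹ × ℝ`. -/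
def immOne (p : ℕ) (J : TopologicalSpace.Opens ℝ) (x y : ℝ → ℝ) (m : Sph p × J) :
    WithLp 2 (EuclideanSpace ℝ (Fin (p + 1)) × ℝ) :=
  WithLp.toLp 2 (x m.2 • (m.1 : EuclideanSpace ℝ (Fin (p + 1))), y m.2)

/-- The unit normal `η = (-ẏ w, ẋ)`. -/
def immOneNormal (p : ℕ) (J : TopologicalSpace.Opens ℝ) (x y : ℝ → ℝ) :
    Sph p × J → WithLp 2 (EuclideanSpace ℝ (Fin (p + 1)) × ℝ) :=
  immOne p J (fun s => -deriv y s) (deriv x)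

/-- `f = α̇ + p ẏ / x`. -/
def meanCurvOne (p : ℕ) (x y α : ℝ → ℝ) (s : ℝ) : ℝ :=
  deriv α s + p * (deriv y s / x s)

end One

end Biharmonic

end

open Biharmonic

/-! The Christoffel symbols of an induced metric are the tangential coefficients of the second
derivatives of the parametrization. Hence the trace of a Hessian at a point needs only the 2-jets of
the maps in a chart, evaluated on an orthonormal frame (`traceHessian_metricMatrix`). The
stereographic chart of a unit sphere is, at its centre, isometric to first order with purely radial
second derivative (`isSphericalJet_sphereParam`).

Consequently the trace of the second derivative preserves the maps (a(s) w, b(s) z) and acts on them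
by an ordinary differential operator: a goes to a'' + (p x'/x + q y'/y) a' - p a/x², and b likewise
with q b/y² (`RotationChart.traceSecondDerivative_eq`). Applied to (x, y) it yields the tension
field f η (`RotationChart.tension_eq`); applied to f η, that is to a = -f sin α and b = f cos α, it
yields the bitension field. After α'' is traded for f', the latter is -f'(f + 2α') times dφ(∂ₛ) plus
the stated second-order expression times η (`RotationChart.bitension_eq`). Both vectors are nonzero,
one tangent and one normal, so each part vanishes exactly when its coefficient does.

The first-order claims come from |dφ(X, Y, c)|² = x²|X|² + y²|Y|² + c² and from comparing dη with
dφ.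

The second family is the case q = 0, the second sphere being replaced by the constant 1 in ℝ. There
y may vanish, so y ≠ 0 is assumed in the form `Fin q → y s ≠ 0`, which is empty for q = 0. -/

namespace Biharmonic

/-! ### The trace of the Hessian for an induced metric. -/

section TraceHessian

variable {V : Type*} [NormedAddCommGroup V] [NormedSpace ℝ V]
  {E : Type*} [NormedAddCommGroup E] [InnerProductSpace ℝ E]
  {F : Type*} [NormedAddCommGroup F] [NormedSpace ℝ F]
  {ι κ : Type*}

theorem differentiableAt_fderiv {u : V → F} {ξ : V} (hu : ContDiffAt ℝ 2 u ξ) :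
    DifferentiableAt ℝ (fderiv ℝ u) ξ :=
  (hu.fderiv_right (m := 1) (by norm_num)).differentiableAt (by norm_num)

theorem pd_pd (b : Module.Basis ι ℝ V) {u : V → F} {ξ : V} (hu : ContDiffAt ℝ 2 u ξ) (i j : ι) :
    pd b i (fun ζ => pd b j u ζ) ξ = fderiv ℝ (fderiv ℝ u) ξ (b i) (b j) := by
  unfold pd
  rw [fderiv_clm_apply (differentiableAt_fderiv hu) (differentiableAt_const _)]
  simp

theorem pd_metricMatrix (b : Module.Basis ι ℝ V) {u : V → E} {ξ : V} (hu : ContDiffAt ℝ 2 u ξ)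
    (k i j : ι) :
    pd b k (fun ζ => metricMatrix b u ζ i j) ξ =
      inner ℝ (fderiv ℝ u ξ (b i)) (fderiv ℝ (fderiv ℝ u) ξ (b k) (b j)) +
      inner ℝ (fderiv ℝ (fderiv ℝ u) ξ (b k) (b i)) (fderiv ℝ u ξ (b j)) := by
  have hd : ∀ l, DifferentiableAt ℝ (fun ζ => pd b l u ζ) ξ := fun l =>
    (differentiableAt_fderiv hu).clm_apply (differentiableAt_const _)
  have h := fderiv_inner_apply ℝ (hd i) (hd j) (b k)
  have h1 := pd_pd b hu k i
  have h2 := pd_pd b hu k j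
  simp only [metricMatrix, Matrix.of_apply]
  change fderiv ℝ (fun ζ => inner ℝ (pd b i u ζ) (pd b j u ζ)) ξ (b k) = _
  rw [h, ← h1, ← h2]
  rfl

variable [Fintype ι] [DecidableEq ι]

/-- The Gauss formula in coordinates: the Christoffel symbols of an induced metric. -/
theorem christoffel_metricMatrix (b : Module.Basis ι ℝ V) {u : V → E} {ξ : V}
    (hu : ContDiffAt ℝ 2 u ξ) (k i j : ι) :
    christoffel b (metricMatrix b u) k i j ξ = ∑ l, (metricMatrix b u ξ)⁻¹ k l *
      inner ℝ (fderiv ℝ (fderiv ℝ u) ξ (b i) (b j)) (fderiv ℝ u ξ (b l)) := by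
  have hs : ∀ X Y, fderiv ℝ (fderiv ℝ u) ξ X Y = fderiv ℝ (fderiv ℝ u) ξ Y X := fun X Y =>
    (hu.isSymmSndFDerivAt (by simp)).eq X Y
  unfold christoffel
  rw [Finset.mul_sum]
  refine Finset.sum_congr rfl fun l _ => ?_
  rw [pd_metricMatrix b hu, pd_metricMatrix b hu, pd_metricMatrix b hu, hs (b j) (b i),
    hs (b l) (b i), hs (b l) (b j), real_inner_comm (fderiv ℝ (fderiv ℝ u) ξ (b i) (b l)),
    real_inner_comm (fderiv ℝ (fderiv ℝ u) ξ (b j) (b l))]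
  ring

variable [Fintype κ] [DecidableEq κ]

/-- If P holds the coordinates of `b` in `e`, orthonormality gives G = PᵀP; the transition matrix in
the other direction is P⁻¹. -/
theorem metricMatrix_inv (b : Module.Basis ι ℝ V) (e : Module.Basis κ ℝ V) {u : V → E} {ξ : V}
    (he : Orthonormal ℝ fun k => fderiv ℝ u ξ (e k)) :
    (metricMatrix b u ξ)⁻¹ = b.toMatrix e * (b.toMatrix e).transpose := by
  have hG : metricMatrix b u ξ = (e.toMatrix b).transpose * e.toMatrix b := by
    ext i j
    have hb : ∀ i, fderiv ℝ u ξ (b i) = ∑ a, e.repr (b i) a • fderiv ℝ u ξ (e a) := fun i => by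
      conv_lhs => rw [← e.sum_repr (b i)]
      rw [map_sum]
      simp only [map_smul]
    simp only [metricMatrix, Matrix.of_apply, pd, hb]
    rw [he.inner_sum]
    simp [Matrix.mul_apply, Module.Basis.toMatrix_apply]
  refine Matrix.inv_eq_right_inv ?_
  rw [hG, Matrix.mul_assoc, ← Matrix.mul_assoc (e.toMatrix b),
    Module.Basis.toMatrix_mul_toMatrix_flip, Matrix.one_mul, ← Matrix.transpose_mul,
    Module.Basis.toMatrix_mul_toMatrix_flip, Matrix.transpose_one]

/-- The metric trace of a bilinear form does not depend on the basis; this replaces the chart's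
fixed basis by any convenient orthonormal frame. -/
theorem sum_metricMatrix_inv_smul (b : Module.Basis ι ℝ V) (e : Module.Basis κ ℝ V) {u : V → E}
    {ξ : V} (he : Orthonormal ℝ fun k => fderiv ℝ u ξ (e k)) (B : V →ₗ[ℝ] V →ₗ[ℝ] F) :
    ∑ i, ∑ j, (metricMatrix b u ξ)⁻¹ i j • B (b i) (b j) = ∑ a, B (e a) (e a) := by
  have hB : ∀ a, B (e a) (e a) =
      ∑ i, ∑ j, (b.repr (e a) i * b.repr (e a) j) • B (b i) (b j) := fun a => by
    conv_lhs => rw [← b.sum_repr (e a)]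
    simp only [map_sum, LinearMap.sum_apply, map_smul, LinearMap.smul_apply, Finset.smul_sum,
      smul_smul]
    rw [Finset.sum_comm]
    refine Finset.sum_congr rfl fun i _ => Finset.sum_congr rfl fun j _ => ?_
    rw [mul_comm]
  simp only [hB, metricMatrix_inv b e he, Matrix.mul_apply, Matrix.transpose_apply,
    Module.Basis.toMatrix_apply, Finset.sum_smul]
  rw [Finset.sum_comm (s := (Finset.univ : Finset κ))]
  refine Finset.sum_congr rfl fun i _ => ?_
  rw [Finset.sum_comm]

/-- The trace of the Hessian for an induced metric, in terms of an orthonormal frame. -/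
theorem traceHessian_metricMatrix (b : Module.Basis ι ℝ V) (e : Module.Basis κ ℝ V) {u : V → E}
    {v : V → F} {ξ : V} (hu : ContDiffAt ℝ 2 u ξ) (hv : ContDiffAt ℝ 2 v ξ)
    (he : Orthonormal ℝ fun k => fderiv ℝ u ξ (e k)) :
    traceHessian b (metricMatrix b u) v ξ =
      ∑ a, fderiv ℝ (fderiv ℝ v) ξ (e a) (e a) -
      ∑ a, inner ℝ (∑ c, fderiv ℝ (fderiv ℝ u) ξ (e c) (e c)) (fderiv ℝ u ξ (e a)) •
        fderiv ℝ v ξ (e a) := by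
  let toBilin : (V →L[ℝ] V →L[ℝ] F) → (V →ₗ[ℝ] V →ₗ[ℝ] F) := fun B =>
    LinearMap.mk₂ ℝ (fun X Y => B X Y) (by simp) (by simp) (by simp) (by simp)
  -- By the Gauss formula the sum over `k` is itself a metric trace, of the form (X, Y) ↦ ⟨∂ᵢ∂ⱼu,
  -- du(Y)⟩ dv(X).
  have h1 : ∀ i j, ∑ k, christoffel b (metricMatrix b u) k i j ξ • pd b k v ξ =
      ∑ a, inner ℝ (fderiv ℝ (fderiv ℝ u) ξ (b i) (b j)) (fderiv ℝ u ξ (e a)) •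
        fderiv ℝ v ξ (e a) := fun i j => by
    have := sum_metricMatrix_inv_smul b e he (LinearMap.mk₂ ℝ (fun X Y =>
      (inner ℝ (fderiv ℝ (fderiv ℝ u) ξ (b i) (b j)) (fderiv ℝ u ξ Y) : ℝ) • fderiv ℝ v ξ X)
      (by simp) (fun c X Y => by rw [map_smul, smul_comm])
      (fun X Y Z => by rw [map_add, inner_add_right, add_smul])
      (fun c X Y => by rw [map_smul, inner_smul_right, mul_smul]))
    simp only [LinearMap.mk₂_apply] at this
    rw [← this]
    simp only [christoffel_metricMatrix b hu, Finset.sum_smul, pd, mul_smul]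
  have h2 := sum_metricMatrix_inv_smul b e he (toBilin (fderiv ℝ (fderiv ℝ v) ξ))
  have h3 := sum_metricMatrix_inv_smul b e he (LinearMap.mk₂ ℝ (fun X Y =>
      ∑ a, (inner ℝ (fderiv ℝ (fderiv ℝ u) ξ X Y) (fderiv ℝ u ξ (e a)) : ℝ) • fderiv ℝ v ξ (e a))
      (fun X Y Z => by
        simp only [map_add, add_apply, inner_add_left, add_smul, Finset.sum_add_distrib])
      (fun c X Y => by
        simp only [map_smul, smul_apply, real_inner_smul_left, mul_smul, Finset.smul_sum])
      (fun X Y Z => by simp only [map_add, inner_add_left, add_smul, Finset.sum_add_distrib])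
      (fun c X Y => by
        simp only [map_smul, real_inner_smul_left, mul_smul, Finset.smul_sum]))
  simp only [LinearMap.mk₂_apply, toBilin] at h2 h3
  unfold traceHessian
  simp only [h1, pd_pd b hv, smul_sub, Finset.sum_sub_distrib]
  rw [h2, h3, Finset.sum_comm]
  simp only [sum_inner, Finset.sum_smul]

/-- Traces in an orthonormal frame only see diagonal values of the second derivative, so calculus
along straight lines suffices. -/
theorem fderiv_fderiv_apply_self {v : V → F} {ξ : V} (hv : ContDiffAt ℝ 2 v ξ) (X : V) :
    fderiv ℝ (fderiv ℝ v) ξ X X = deriv (deriv fun t : ℝ => v (ξ + t • X)) 0 := by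
  have hline : ∀ t : ℝ, HasDerivAt (fun t : ℝ => ξ + t • X) X t := fun t => by
    simpa using ((hasDerivAt_id t).smul_const X).const_add ξ
  have hcont : Filter.Tendsto (fun t : ℝ => ξ + t • X) (nhds 0) (nhds ξ) := by
    have := (hline 0).continuousAt
    simpa [ContinuousAt] using this
  have h1 : deriv (fun t : ℝ => v (ξ + t • X)) =ᶠ[nhds 0] fun t => fderiv ℝ v (ξ + t • X) X := by
    filter_upwards [hcont.eventually (hv.eventually (by simp))] with t ht
    exact ((ht.differentiableAt (by norm_num)).hasFDerivAt.comp_hasDerivAt t (hline t)).deriv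
  rw [h1.deriv_eq]
  have h2 : HasFDerivAt (fun ζ => fderiv ℝ v ζ X)
      ((ContinuousLinearMap.apply ℝ F X).comp (fderiv ℝ (fderiv ℝ v) ξ)) (ξ + (0 : ℝ) • X) := by
    rw [zero_smul, add_zero]
    exact (ContinuousLinearMap.apply ℝ F X).hasFDerivAt.comp ξ
      (differentiableAt_fderiv hv).hasFDerivAt
  have h3 : HasDerivAt (fun t : ℝ => fderiv ℝ v (ξ + t • X) X) (fderiv ℝ (fderiv ℝ v) ξ X X) 0 := by
    have h := h2.comp_hasDerivAt (0 : ℝ) (hline 0)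
    exact h
  exact h3.deriv.symm

end TraceHessian

/-! ### Manifold derivatives read in a chart. -/

section Charts

variable {V : Type*} [NormedAddCommGroup V] [NormedSpace ℝ V]
  {H : Type*} [TopologicalSpace H] (I : ModelWithCorners ℝ V H) [I.Boundaryless]
  {M : Type*} [TopologicalSpace M] [ChartedSpace H M]
  {F : Type*} [NormedAddCommGroup F] [NormedSpace ℝ F]

theorem mvfderiv_eq_fderiv {φ : M → F} {m : M}
    (h : DifferentiableAt ℝ (φ ∘ (extChartAt I m).symm) (extChartAt I m m)) :
    mvfderiv I φ m = fderiv ℝ (φ ∘ (extChartAt I m).symm) (extChartAt I m m) := by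
  -- Manifold differentiability demands continuity of `φ` itself, which is recovered from its chart
  -- expression.
  have hc : ContinuousAt φ m := by
    have h1 : ContinuousAt ((φ ∘ (extChartAt I m).symm) ∘ extChartAt I m) m :=
      h.continuousAt.comp (continuousAt_extChartAt m)
    refine h1.congr ?_
    filter_upwards [extChartAt_source_mem_nhds (I := I) m] with a ha
    exact congrArg φ ((extChartAt I m).left_inv ha)
  have hm : MDifferentiableAt I 𝓘(ℝ, F) φ m := by
    rw [mdifferentiableAt_iff]
    refine ⟨hc, ?_⟩
    exact h.differentiableWithinAt
  rw [hm.mvfderiv, I.range_eq_univ, fderivWithin_univ]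
  rfl

end Charts

/-! ### Calculus in an L² product, a linear homeomorphic copy of the ordinary product. -/

section PairCalculus

variable {W E F : Type*} [NormedAddCommGroup W] [NormedSpace ℝ W]
  [NormedAddCommGroup E] [InnerProductSpace ℝ E] [NormedAddCommGroup F] [InnerProductSpace ℝ F]

theorem hasFDerivAt_toLp_prodMk {f : W → E} {g : W → F} {f' : W →L[ℝ] E} {g' : W →L[ℝ] F} {ξ : W}
    (hf : HasFDerivAt f f' ξ) (hg : HasFDerivAt g g' ξ) :
    HasFDerivAt (fun ζ => WithLp.toLp 2 (f ζ, g ζ))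
      ((WithLp.prodContinuousLinearEquiv 2 ℝ E F).symm.toContinuousLinearMap ∘L (f'.prod g')) ξ :=
  (WithLp.prodContinuousLinearEquiv 2 ℝ E F).symm.hasFDerivAt.comp ξ (hf.prodMk hg)

theorem hasDerivAt_toLp_prodMk {f : ℝ → E} {g : ℝ → F} {f' : E} {g' : F} {t : ℝ}
    (hf : HasDerivAt f f' t) (hg : HasDerivAt g g' t) :
    HasDerivAt (fun τ => WithLp.toLp 2 (f τ, g τ)) (WithLp.toLp 2 (f', g')) t := by
  have h := (WithLp.prodContinuousLinearEquiv 2 ℝ E F).symm.hasFDerivAt.comp_hasDerivAt t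
    (hf.prodMk hg)
  exact h

theorem contDiffAt_toLp_prodMk {n : WithTop ℕ∞} {f : W → E} {g : W → F} {ξ : W}
    (hf : ContDiffAt ℝ n f ξ) (hg : ContDiffAt ℝ n g ξ) :
    ContDiffAt ℝ n (fun ζ => WithLp.toLp 2 (f ζ, g ζ)) ξ :=
  (WithLp.prodContinuousLinearEquiv 2 ℝ E F).symm.contDiff.contDiffAt.comp ξ (hf.prodMk hg)

theorem differentiableAt_deriv {f : ℝ → E} {t : ℝ} (hf : ContDiffAt ℝ 2 f t) :
    DifferentiableAt ℝ (deriv f) t :=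
  (hf.derivWithin (m := 1) (by norm_num)).differentiableAt (by norm_num)

theorem deriv_deriv_toLp_prodMk {f : ℝ → E} {g : ℝ → F} {t : ℝ}
    (hf : ContDiffAt ℝ 2 f t) (hg : ContDiffAt ℝ 2 g t) :
    deriv (deriv fun τ => WithLp.toLp 2 (f τ, g τ)) t =
      WithLp.toLp 2 (deriv (deriv f) t, deriv (deriv g) t) := by
  have h : deriv (fun τ => WithLp.toLp 2 (f τ, g τ)) =ᶠ[nhds t]
      fun τ => WithLp.toLp 2 (deriv f τ, deriv g τ) := by
    filter_upwards [hf.eventually (by simp), hg.eventually (by simp)] with τ h1 h2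
    exact (hasDerivAt_toLp_prodMk (h1.differentiableAt (by norm_num)).hasDerivAt
      (h2.differentiableAt (by norm_num)).hasDerivAt).deriv
  rw [h.deriv_eq]
  exact (hasDerivAt_toLp_prodMk (differentiableAt_deriv hf).hasDerivAt
    (differentiableAt_deriv hg).hasDerivAt).deriv

end PairCalculus
-- First and second derivatives of rotation maps.
section Rotation

variable {W₁ W₂ E₁ E₂ : Type*} [NormedAddCommGroup W₁] [InnerProductSpace ℝ W₁]
  [NormedAddCommGroup W₂] [InnerProductSpace ℝ W₂]
  [NormedAddCommGroup E₁] [InnerProductSpace ℝ E₁] [NormedAddCommGroup E₂] [InnerProductSpace ℝ E₂]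

/-- The second-order behaviour at its centre of a parametrization of the unit sphere that is
isometric to first order and geodesic to second order. -/
structure IsSphericalJet (σ : W₁ → E₁) : Prop where
  contDiffAt : ContDiffAt ℝ 2 σ 0
  norm_zero : ‖σ 0‖ = 1
  inner_fderiv : ∀ X Y, inner ℝ (fderiv ℝ σ 0 X) (fderiv ℝ σ 0 Y) = (inner ℝ X Y : ℝ)
  inner_fderiv_zero : ∀ X, inner ℝ (fderiv ℝ σ 0 X) (σ 0) = (0 : ℝ)
  deriv_deriv : ∀ X, deriv (deriv fun t : ℝ => σ (t • X)) 0 = -(‖X‖ ^ 2 • σ 0)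

/-- The map `(ξ, ζ, s) ↦ (a(s) σ₁(ξ), b(s) σ₂(ζ))`. -/
def rotationMap (σ₁ : W₁ → E₁) (σ₂ : W₂ → E₂) (a b : ℝ → ℝ) (ξ : W₁ × (W₂ × ℝ)) :
    WithLp 2 (E₁ × E₂) :=
  WithLp.toLp 2 (a ξ.2.2 • σ₁ ξ.1, b ξ.2.2 • σ₂ ξ.2.1)

variable {σ₁ : W₁ → E₁} {σ₂ : W₂ → E₂} {a b : ℝ → ℝ} {s : ℝ}

theorem contDiffAt_rotationMap {n : WithTop ℕ∞} (h₁ : ContDiffAt ℝ n σ₁ 0)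
    (h₂ : ContDiffAt ℝ n σ₂ 0) (ha : ContDiffAt ℝ n a s) (hb : ContDiffAt ℝ n b s) :
    ContDiffAt ℝ n (rotationMap σ₁ σ₂ a b) (0, 0, s) := by
  have hs : ContDiffAt ℝ n (fun ξ : W₁ × (W₂ × ℝ) => ξ.2.2) (0, 0, s) :=
    (contDiff_snd.comp contDiff_snd).contDiffAt
  have h1 : ContDiffAt ℝ n (fun ξ : W₁ × (W₂ × ℝ) => ξ.1) (0, 0, s) := contDiff_fst.contDiffAt
  have h2 : ContDiffAt ℝ n (fun ξ : W₁ × (W₂ × ℝ) => ξ.2.1) (0, 0, s) :=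
    (contDiff_fst.comp contDiff_snd).contDiffAt
  exact contDiffAt_toLp_prodMk
    ((ContDiffAt.comp (g := a) (0, 0, s) ha hs).smul (ContDiffAt.comp (g := σ₁) (0, 0, s) h₁ h1))
    ((ContDiffAt.comp (g := b) (0, 0, s) hb hs).smul (ContDiffAt.comp (g := σ₂) (0, 0, s) h₂ h2))

theorem fderiv_rotationMap (h₁ : DifferentiableAt ℝ σ₁ 0) (h₂ : DifferentiableAt ℝ σ₂ 0)
    (ha : DifferentiableAt ℝ a s) (hb : DifferentiableAt ℝ b s) (X : W₁ × (W₂ × ℝ)) :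
    fderiv ℝ (rotationMap σ₁ σ₂ a b) (0, 0, s) X = WithLp.toLp 2
      (a s • fderiv ℝ σ₁ 0 X.1 + (X.2.2 * deriv a s) • σ₁ 0,
        b s • fderiv ℝ σ₂ 0 X.2.1 + (X.2.2 * deriv b s) • σ₂ 0) := by
  have hs : HasFDerivAt (fun ξ : W₁ × (W₂ × ℝ) => ξ.2.2)
      ((ContinuousLinearMap.snd ℝ W₂ ℝ).comp (ContinuousLinearMap.snd ℝ W₁ (W₂ × ℝ))) (0, 0, s) :=
    ((ContinuousLinearMap.snd ℝ W₂ ℝ).comp (ContinuousLinearMap.snd ℝ W₁ (W₂ × ℝ))).hasFDerivAt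
  have h1 : HasFDerivAt (fun ξ : W₁ × (W₂ × ℝ) => ξ.1)
      (ContinuousLinearMap.fst ℝ W₁ (W₂ × ℝ)) (0, 0, s) := hasFDerivAt_fst
  have h2 : HasFDerivAt (fun ξ : W₁ × (W₂ × ℝ) => ξ.2.1)
      ((ContinuousLinearMap.fst ℝ W₂ ℝ).comp (ContinuousLinearMap.snd ℝ W₁ (W₂ × ℝ))) (0, 0, s) :=
    ((ContinuousLinearMap.fst ℝ W₂ ℝ).comp (ContinuousLinearMap.snd ℝ W₁ (W₂ × ℝ))).hasFDerivAt
  have ha' := HasFDerivAt.comp (g := a) (0, 0, s) ha.hasFDerivAt hs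
  have hb' := HasFDerivAt.comp (g := b) (0, 0, s) hb.hasFDerivAt hs
  have h1' := HasFDerivAt.comp (g := σ₁) (0, 0, s) h₁.hasFDerivAt h1
  have h2' := HasFDerivAt.comp (g := σ₂) (0, 0, s) h₂.hasFDerivAt h2
  have h := (hasFDerivAt_toLp_prodMk (ha'.smul h1') (hb'.smul h2')).fderiv
  have h' : fderiv ℝ (rotationMap σ₁ σ₂ a b) (0, 0, s) = _ := h
  rw [h']
  simp

/-- Along a line in a direction of the first sphere only `σ₁` varies, and its second derivative is
prescribed by the jet. -/
theorem fderiv_fderiv_rotationMap_fst (h₁ : IsSphericalJet σ₁) (h₂ : IsSphericalJet σ₂)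
    (ha : ContDiffAt ℝ 2 a s) (hb : ContDiffAt ℝ 2 b s) (X : W₁) :
    fderiv ℝ (fderiv ℝ (rotationMap σ₁ σ₂ a b)) (0, 0, s) (X, 0, 0) (X, 0, 0) =
      WithLp.toLp 2 (-(a s * ‖X‖ ^ 2) • σ₁ 0, 0) := by
  rw [fderiv_fderiv_apply_self (contDiffAt_rotationMap h₁.contDiffAt h₂.contDiffAt ha hb)]
  have hc : ContDiffAt ℝ 2 (fun t : ℝ => σ₁ (t • X)) 0 := by
    have h := h₁.contDiffAt
    rw [← zero_smul ℝ X] at h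
    exact h.comp (0 : ℝ) (contDiffAt_id.smul contDiffAt_const)
  have h := deriv_deriv_toLp_prodMk (t := 0) (f := fun t : ℝ => a s • σ₁ (t • X))
    (g := fun _ => b s • σ₂ 0) (contDiffAt_const.smul hc) contDiffAt_const
  simp only [rotationMap, Prod.fst_add, Prod.snd_add, Prod.smul_fst, Prod.smul_snd, zero_add,
    smul_zero, add_zero]
  rw [h]
  have hd : deriv (fun t : ℝ => a s • σ₁ (t • X)) = fun t => a s • deriv (fun t => σ₁ (t • X)) t :=
    funext fun t => deriv_fun_const_smul_field _ _
  rw [hd, deriv_fun_const_smul_field, h₁.deriv_deriv]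
  simp [mul_smul]

theorem fderiv_fderiv_rotationMap_snd (h₁ : IsSphericalJet σ₁) (h₂ : IsSphericalJet σ₂)
    (ha : ContDiffAt ℝ 2 a s) (hb : ContDiffAt ℝ 2 b s) (Y : W₂) :
    fderiv ℝ (fderiv ℝ (rotationMap σ₁ σ₂ a b)) (0, 0, s) (0, Y, 0) (0, Y, 0) =
      WithLp.toLp 2 (0, -(b s * ‖Y‖ ^ 2) • σ₂ 0) := by
  rw [fderiv_fderiv_apply_self (contDiffAt_rotationMap h₁.contDiffAt h₂.contDiffAt ha hb)]
  have hc : ContDiffAt ℝ 2 (fun t : ℝ => σ₂ (t • Y)) 0 := by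
    have h := h₂.contDiffAt
    rw [← zero_smul ℝ Y] at h
    exact h.comp (0 : ℝ) (contDiffAt_id.smul contDiffAt_const)
  have h := deriv_deriv_toLp_prodMk (t := 0) (f := fun _ => a s • σ₁ 0)
    (g := fun t : ℝ => b s • σ₂ (t • Y)) contDiffAt_const (contDiffAt_const.smul hc)
  simp only [rotationMap, Prod.fst_add, Prod.snd_add, Prod.smul_fst, Prod.smul_snd, zero_add,
    smul_zero, add_zero]
  rw [h]
  have hd : deriv (fun t : ℝ => b s • σ₂ (t • Y)) = fun t => b s • deriv (fun t => σ₂ (t • Y)) t :=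
    funext fun t => deriv_fun_const_smul_field _ _
  rw [hd, deriv_fun_const_smul_field, h₂.deriv_deriv]
  simp [mul_smul]

theorem deriv_deriv_smul_const {k : ℝ → ℝ} {t : ℝ} (hk : ContDiffAt ℝ 2 k t) (X : E₁) :
    deriv (deriv fun τ => k τ • X) t = deriv (deriv k) t • X := by
  have h : deriv (fun τ => k τ • X) =ᶠ[nhds t] fun τ => deriv k τ • X := by
    filter_upwards [hk.eventually (by simp)] with τ hτ
    exact deriv_smul_const (hτ.differentiableAt (by norm_num)) X
  rw [h.deriv_eq]
  exact deriv_smul_const (differentiableAt_deriv hk) X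

theorem fderiv_fderiv_rotationMap_profile (h₁ : IsSphericalJet σ₁) (h₂ : IsSphericalJet σ₂)
    (ha : ContDiffAt ℝ 2 a s) (hb : ContDiffAt ℝ 2 b s) :
    fderiv ℝ (fderiv ℝ (rotationMap σ₁ σ₂ a b)) (0, 0, s) (0, 0, 1) (0, 0, 1) =
      WithLp.toLp 2 (deriv (deriv a) s • σ₁ 0, deriv (deriv b) s • σ₂ 0) := by
  rw [fderiv_fderiv_apply_self (contDiffAt_rotationMap h₁.contDiffAt h₂.contDiffAt ha hb)]
  have ht : ContDiffAt ℝ 2 (fun t : ℝ => s + t) 0 := contDiffAt_const.add contDiffAt_id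
  have hs : s + 0 = s := add_zero s
  have ha' : ContDiffAt ℝ 2 (fun t => a (s + t)) 0 := ContDiffAt.comp (g := a) 0 (by rwa [hs]) ht
  have hb' : ContDiffAt ℝ 2 (fun t => b (s + t)) 0 := ContDiffAt.comp (g := b) 0 (by rwa [hs]) ht
  have h := deriv_deriv_toLp_prodMk (t := 0) (f := fun t => a (s + t) • σ₁ 0)
    (g := fun t => b (s + t) • σ₂ 0) (ha'.smul contDiffAt_const) (hb'.smul contDiffAt_const)
  have hsh : ∀ k : ℝ → ℝ, deriv (deriv fun t => k (s + t)) 0 = deriv (deriv k) s := fun k => by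
    rw [show deriv (fun t => k (s + t)) = fun t => deriv k (s + t) from
      funext fun t => deriv_comp_const_add _ _ _, deriv_comp_const_add, hs]
  simp only [rotationMap, Prod.fst_add, Prod.snd_add, Prod.smul_fst, Prod.smul_snd, zero_add,
    smul_zero, smul_eq_mul, mul_one]
  rw [h, deriv_deriv_smul_const ha', deriv_deriv_smul_const hb', hsh, hsh]

end Rotation

/-! ### The 2-jet of the stereographic chart at its centre. -/

section Sphere

/-- The parametrization of the unit sphere by its chart at `w`. -/
noncomputable def sphereParam {n : ℕ} (w : Sph n) (ξ : EuclideanSpace ℝ (Fin n)) :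
    EuclideanSpace ℝ (Fin (n + 1)) :=
  ((extChartAt (𝓡 n) w).symm ξ : Sph n)

theorem extChartAt_sphere_self {n : ℕ} (w : Sph n) : extChartAt (𝓡 n) w w = 0 := by
  have h : chartAt (EuclideanSpace ℝ (Fin n)) w = stereographic' n (-w) := rfl
  simp only [extChartAt_coe, h, stereographic', Function.comp_apply,
    OpenPartialHomeomorph.coe_trans, modelWithCornersSelf_coe, id]
  rw [stereographic_neg_apply]
  exact (OrthonormalBasis.fromOrthogonalSpanSingleton (𝕜 := ℝ) n
    (ne_zero_of_mem_unit_sphere (-w))).repr.map_zero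

theorem sphereParam_zero {n : ℕ} (w : Sph n) : sphereParam w 0 = w := by
  rw [sphereParam, ← extChartAt_sphere_self w, extChartAt_to_inv]

/-- The chart at `w` projects stereographically from the pole `-w` onto the hyperplane orthogonal to
`w`, identified isometrically with ℝⁿ. -/
theorem exists_sphereParam_eq {n : ℕ} (w : Sph n) :
    ∃ U : EuclideanSpace ℝ (Fin n) →ₗᵢ[ℝ] EuclideanSpace ℝ (Fin (n + 1)),
      (∀ ξ, inner ℝ (U ξ) (w : EuclideanSpace ℝ (Fin (n + 1))) = (0 : ℝ)) ∧
      sphereParam w = stereoInvFunAux (-(w : EuclideanSpace ℝ (Fin (n + 1)))) ∘ U := by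
  let V := (OrthonormalBasis.fromOrthogonalSpanSingleton (𝕜 := ℝ) n
    (ne_zero_of_mem_unit_sphere (-w))).repr
  refine ⟨(Submodule.subtypeₗᵢ _).comp V.symm.toLinearIsometry, fun ξ => ?_, ?_⟩
  · have h : inner ℝ (V.symm ξ : EuclideanSpace ℝ (Fin (n + 1)))
        (-(w : EuclideanSpace ℝ (Fin (n + 1)))) = (0 : ℝ) :=
      Submodule.mem_orthogonal_singleton_iff_inner_left.1 (V.symm ξ).2
    rw [inner_neg_right, neg_eq_zero] at h
    exact h
  · funext ξ
    rfl

theorem isSphericalJet_sphereParam {n : ℕ} (w : Sph n) : IsSphericalJet (sphereParam w) := by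
  obtain ⟨U, hU, hσ⟩ := exists_sphereParam_eq w
  have h0 := sphereParam_zero w
  have hw : ‖(w : EuclideanSpace ℝ (Fin (n + 1)))‖ = 1 := by simp
  have hd : HasFDerivAt (sphereParam w) U.toContinuousLinearMap 0 := by
    rw [hσ]
    refine HasFDerivAt.comp (g' := ContinuousLinearMap.id ℝ _) 0 ?_
      U.toContinuousLinearMap.hasFDerivAt
    rw [U.coe_toContinuousLinearMap, map_zero]
    exact hasFDerivAt_stereoInvFunAux _
  refine ⟨?_, by rw [h0, hw], fun X Y => ?_, fun X => ?_, fun X => ?_⟩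
  · rw [hσ]
    exact (contDiff_stereoInvFunAux.comp U.contDiff).contDiffAt
  · rw [hd.fderiv]
    exact U.inner_map_map X Y
  · rw [hd.fderiv, h0]
    exact hU X
  -- With D(t) = 1/(t²|X|² + 4), the coefficient 4tD of `U X` is odd, so its second derivative at 0
  -- vanishes; D''(0) = -|X|²/8 then gives -|X|² as the coefficient of `w`.
  · have hline : (fun t : ℝ => sphereParam w (t • X)) = fun t =>
        (t * (4 * (t ^ 2 * ‖X‖ ^ 2 + 4)⁻¹)) • U X +
          (8 * (t ^ 2 * ‖X‖ ^ 2 + 4)⁻¹ - 1) • (w : EuclideanSpace ℝ (Fin (n + 1))) := by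
      funext t
      have hpos : t ^ 2 * ‖X‖ ^ 2 + 4 ≠ 0 := by positivity
      rw [hσ]
      simp only [Function.comp_apply, stereoInvFunAux_apply, U.norm_map, norm_smul, map_smul,
        mul_pow, Real.norm_eq_abs, sq_abs]
      match_scalars
      · ring
      · field_simp
        ring
    set D : ℝ → ℝ := fun t => (t ^ 2 * ‖X‖ ^ 2 + 4)⁻¹ with hD
    have hpos : ∀ t : ℝ, t ^ 2 * ‖X‖ ^ 2 + 4 ≠ 0 := fun t => by positivity
    have hDd : ∀ t, HasDerivAt D (-(2 * t * ‖X‖ ^ 2) * D t ^ 2) t := fun t => by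
      have h := (((hasDerivAt_pow 2 t).mul_const (‖X‖ ^ 2)).add_const 4).inv (hpos t)
      refine h.congr_deriv ?_
      simp only [hD]
      field_simp
      push_cast
      ring
    have h1 : deriv (fun t : ℝ => sphereParam w (t • X)) = fun t =>
        (4 * D t + t * (4 * (-(2 * t * ‖X‖ ^ 2) * D t ^ 2))) • U X +
          (8 * (-(2 * t * ‖X‖ ^ 2) * D t ^ 2)) • (w : EuclideanSpace ℝ (Fin (n + 1))) := by
      rw [hline]
      funext t
      have hA := ((hasDerivAt_id t).mul ((hDd t).const_mul 4)).smul_const (U X)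
      have hB := (((hDd t).const_mul 8).sub_const 1).smul_const
        (w : EuclideanSpace ℝ (Fin (n + 1)))
      refine ((hA.add hB).congr_deriv ?_).deriv
      simp
    rw [h1, h0]
    have hsq := (hDd 0).pow 2
    have hlin : HasDerivAt (fun t : ℝ => -(2 * t * ‖X‖ ^ 2)) (-(2 * 1 * ‖X‖ ^ 2)) 0 :=
      (((hasDerivAt_id (0 : ℝ)).const_mul 2).mul_const _).neg
    have hE := hlin.mul hsq
    have hA := (((hDd 0).const_mul 4).add ((hasDerivAt_id (0 : ℝ)).mul
      (hE.const_mul 4))).smul_const (U X)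
    have hB := (hE.const_mul 8).smul_const (w : EuclideanSpace ℝ (Fin (n + 1)))
    refine ((hA.add hB).congr_deriv ?_).deriv
    have hD0 : D 0 = 4⁻¹ := by simp [hD]
    simp [hD0]
    module

/-- The zero-dimensional second factor that makes 𝕊ᵖ × J the case q = 0. -/
theorem isSphericalJet_const : IsSphericalJet (fun _ : EuclideanSpace ℝ (Fin 0) => (1 : ℝ)) where
  contDiffAt := contDiffAt_const
  norm_zero := by simp
  inner_fderiv X Y := by simp [Subsingleton.elim X 0]
  inner_fderiv_zero X := by simp
  deriv_deriv X := by simp [Subsingleton.elim X 0]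

end Sphere

/-! ### The chart of an open subset of the line. -/

section Interval

/-- This chart is the inclusion, and its inverse is meaningful only on its target, hence the
restriction to a neighbourhood of `s`. -/
theorem val_extChartAt_symm_opens (J : TopologicalSpace.Opens ℝ) (s : J) :
    ∀ᶠ t in nhds (s : ℝ), (((extChartAt 𝓘(ℝ, ℝ) s).symm t : J) : ℝ) = t := by
  have h := extChartAt_target_mem_nhds (I := 𝓘(ℝ, ℝ)) s
  have hs : extChartAt 𝓘(ℝ, ℝ) s s = (s : ℝ) := rfl
  rw [hs] at h
  filter_upwards [h] with t ht
  exact (extChartAt 𝓘(ℝ, ℝ) s).right_inv ht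

end Interval

/-! ### A basis that becomes orthonormal for the induced metric. -/

section Frame

/-- The basis of `ℝᵖ × (ℝ^q × ℝ)` obtained from the standard one by scaling the first two factors. -/
noncomputable def scaledBasis (p q : ℕ) (r₁ r₂ : ℝˣ) : Module.Basis (Fin p ⊕ Fin q ⊕ Unit) ℝ
    (EuclideanSpace ℝ (Fin p) × (EuclideanSpace ℝ (Fin q) × ℝ)) :=
  ((EuclideanSpace.basisFun (Fin p) ℝ).toBasis.unitsSMul fun _ => r₁).prod
    (((EuclideanSpace.basisFun (Fin q) ℝ).toBasis.unitsSMul fun _ => r₂).prod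
      (Module.Basis.singleton Unit ℝ))

variable {p q : ℕ} (r₁ r₂ : ℝˣ)

theorem scaledBasis_inl (i : Fin p) : scaledBasis p q r₁ r₂ (Sum.inl i) =
    ((r₁ : ℝ) • EuclideanSpace.basisFun (Fin p) ℝ i, 0, 0) := by
  simp [scaledBasis, Module.Basis.unitsSMul_apply, Units.smul_def, Prod.zero_eq_mk]

theorem scaledBasis_inr_inl (j : Fin q) : scaledBasis p q r₁ r₂ (Sum.inr (Sum.inl j)) =
    (0, (r₂ : ℝ) • EuclideanSpace.basisFun (Fin q) ℝ j, 0) := by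
  simp [scaledBasis, Module.Basis.unitsSMul_apply, Units.smul_def]

theorem scaledBasis_inr_inr (k : Unit) : scaledBasis p q r₁ r₂ (Sum.inr (Sum.inr k)) =
    (0, 0, 1) := by
  simp [scaledBasis]

end Frame

/-! ### Derivatives and trace of the Hessian in a rotation chart. -/

section RotationChart

variable {V : Type*} [NormedAddCommGroup V] [NormedSpace ℝ V]
  {H : Type*} [TopologicalSpace H] (I : ModelWithCorners ℝ V H)
  {M : Type*} [TopologicalSpace M] [ChartedSpace H M]
  {E₁ E₂ : Type*} [NormedAddCommGroup E₁] [InnerProductSpace ℝ E₁]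
  [NormedAddCommGroup E₂] [InnerProductSpace ℝ E₂]

/-- A family `R a b` of maps `M → E₁ × E₂` that has, in the chart of `M` at `m`, the form
`(a(s) σ₁, b(s) σ₂)` with parametrizations `σ₁` and `σ₂` of unit spheres. -/
structure RotationChart (p q : ℕ) (R : (ℝ → ℝ) → (ℝ → ℝ) → M → WithLp 2 (E₁ × E₂)) (m : M)
    (s : ℝ) where
  Φ : V ≃L[ℝ] EuclideanSpace ℝ (Fin p) × (EuclideanSpace ℝ (Fin q) × ℝ)
  σ₁ : EuclideanSpace ℝ (Fin p) → E₁
  σ₂ : EuclideanSpace ℝ (Fin q) → E₂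
  jet₁ : IsSphericalJet σ₁
  jet₂ : IsSphericalJet σ₂
  Φ_center : Φ (extChartAt I m m) = (0, 0, s)
  eventuallyEq : ∀ a b, R a b ∘ (extChartAt I m).symm =ᶠ[nhds (extChartAt I m m)]
    rotationMap σ₁ σ₂ a b ∘ Φ

namespace RotationChart

variable {I} {p q : ℕ} {R : (ℝ → ℝ) → (ℝ → ℝ) → M → WithLp 2 (E₁ × E₂)} {m : M} {s : ℝ}
  (C : RotationChart I p q R m s) {a b x y : ℝ → ℝ}

theorem apply_center (a b : ℝ → ℝ) :
    R a b m = WithLp.toLp 2 (a s • C.σ₁ 0, b s • C.σ₂ 0) := by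
  have h := (C.eventuallyEq a b).self_of_nhds
  simp only [Function.comp_apply, C.Φ_center, extChartAt_to_inv] at h
  exact h

theorem contDiffAt (C : RotationChart I p q R m s) (ha : ContDiffAt ℝ 2 a s) (hb : ContDiffAt ℝ 2 b s) :
    ContDiffAt ℝ 2 (R a b ∘ (extChartAt I m).symm) (extChartAt I m m) := by
  refine ContDiffAt.congr_of_eventuallyEq ?_ (C.eventuallyEq a b)
  refine ContDiffAt.comp (extChartAt I m m) ?_ C.Φ.contDiff.contDiffAt
  rw [C.Φ_center]
  exact contDiffAt_rotationMap C.jet₁.contDiffAt C.jet₂.contDiffAt ha hb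

theorem fderiv_eq (ha : DifferentiableAt ℝ a s) (hb : DifferentiableAt ℝ b s) (X : V) :
    fderiv ℝ (R a b ∘ (extChartAt I m).symm) (extChartAt I m m) X = WithLp.toLp 2
      (a s • fderiv ℝ C.σ₁ 0 (C.Φ X).1 + ((C.Φ X).2.2 * deriv a s) • C.σ₁ 0,
        b s • fderiv ℝ C.σ₂ 0 (C.Φ X).2.1 + ((C.Φ X).2.2 * deriv b s) • C.σ₂ 0) := by
  rw [(C.eventuallyEq a b).fderiv_eq, C.Φ.comp_right_fderiv, C.Φ_center,
    ContinuousLinearMap.comp_apply, ContinuousLinearEquiv.coe_coe,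
    fderiv_rotationMap (C.jet₁.contDiffAt.differentiableAt (by norm_num))
      (C.jet₂.contDiffAt.differentiableAt (by norm_num)) ha hb]

/-- Since `Φ` is linear it carries lines to lines, and no first-derivative term appears. -/
theorem fderiv_fderiv_eq (ha : ContDiffAt ℝ 2 a s) (hb : ContDiffAt ℝ 2 b s) (X : V) :
    fderiv ℝ (fderiv ℝ (R a b ∘ (extChartAt I m).symm)) (extChartAt I m m) X X =
      fderiv ℝ (fderiv ℝ (rotationMap C.σ₁ C.σ₂ a b)) (0, 0, s) (C.Φ X) (C.Φ X) := by
  have hr := contDiffAt_rotationMap C.jet₁.contDiffAt C.jet₂.contDiffAt ha hb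
  have hc : ContDiffAt ℝ 2 (rotationMap C.σ₁ C.σ₂ a b ∘ C.Φ) (extChartAt I m m) := by
    refine ContDiffAt.comp (extChartAt I m m) ?_ C.Φ.contDiff.contDiffAt
    rwa [C.Φ_center]
  rw [(C.eventuallyEq a b).fderiv.fderiv_eq, fderiv_fderiv_apply_self hc,
    fderiv_fderiv_apply_self hr]
  simp only [Function.comp_apply, map_add, map_smul, C.Φ_center]

theorem mvfderiv_eq [I.Boundaryless] (ha : DifferentiableAt ℝ a s) (hb : DifferentiableAt ℝ b s)
    (X : V) :
    mvfderiv I (R a b) m X = WithLp.toLp 2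
      (a s • fderiv ℝ C.σ₁ 0 (C.Φ X).1 + ((C.Φ X).2.2 * deriv a s) • C.σ₁ 0,
        b s • fderiv ℝ C.σ₂ 0 (C.Φ X).2.1 + ((C.Φ X).2.2 * deriv b s) • C.σ₂ 0) := by
  have hd : DifferentiableAt ℝ (R a b ∘ (extChartAt I m).symm) (extChartAt I m m) := by
    refine DifferentiableAt.congr_of_eventuallyEq ?_ (C.eventuallyEq a b)
    refine DifferentiableAt.comp (extChartAt I m m) ?_ C.Φ.differentiableAt
    have h1 : DifferentiableAt ℝ (fun ξ : EuclideanSpace ℝ (Fin p) ×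
        (EuclideanSpace ℝ (Fin q) × ℝ) => ξ.2.2) (0, 0, s) := by fun_prop
    rw [C.Φ_center]
    have hσ₁ := C.jet₁.contDiffAt.differentiableAt (by norm_num)
    have hσ₂ := C.jet₂.contDiffAt.differentiableAt (by norm_num)
    exact (hasFDerivAt_toLp_prodMk
      ((DifferentiableAt.comp (g := a) (0, 0, s) ha h1).smul
        (DifferentiableAt.comp (g := C.σ₁) (0, 0, s) hσ₁ differentiableAt_fst)).hasFDerivAt
      ((DifferentiableAt.comp (g := b) (0, 0, s) hb h1).smul
        (DifferentiableAt.comp (g := C.σ₂) (0, 0, s) hσ₂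
          (differentiableAt_snd.fst))).hasFDerivAt).differentiableAt
  rw [mvfderiv_eq_fderiv I hd]
  exact C.fderiv_eq ha hb X

/-- Mixed terms drop out because the tangent vectors of each sphere are orthogonal to its unit
position vector. -/
theorem inner_toLp (c d c' d' e f e' f' : ℝ) (X X' : EuclideanSpace ℝ (Fin p))
    (Y Y' : EuclideanSpace ℝ (Fin q)) :
    inner ℝ (WithLp.toLp 2 (c • fderiv ℝ C.σ₁ 0 X + d • C.σ₁ 0,
        e • fderiv ℝ C.σ₂ 0 Y + f • C.σ₂ 0))
      (WithLp.toLp 2 (c' • fderiv ℝ C.σ₁ 0 X' + d' • C.σ₁ 0,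
        e' • fderiv ℝ C.σ₂ 0 Y' + f' • C.σ₂ 0)) =
      c * c' * inner ℝ X X' + e * e' * inner ℝ Y Y' + (d * d' + f * f') := by
  have h1 := C.jet₁.inner_fderiv_zero
  have h2 := C.jet₂.inner_fderiv_zero
  have h1' : ∀ X, inner ℝ (C.σ₁ 0) (fderiv ℝ C.σ₁ 0 X) = (0 : ℝ) := fun X => by
    rw [real_inner_comm, h1]
  have h2' : ∀ X, inner ℝ (C.σ₂ 0) (fderiv ℝ C.σ₂ 0 X) = (0 : ℝ) := fun X => by
    rw [real_inner_comm, h2]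
  simp only [WithLp.prod_inner_apply, inner_add_left, inner_add_right, real_inner_smul_left,
    real_inner_smul_right, C.jet₁.inner_fderiv, C.jet₂.inner_fderiv, h1, h2, h1', h2',
    real_inner_self_eq_norm_sq, C.jet₁.norm_zero, C.jet₂.norm_zero]
  ring

/-- The frame of `V` that corresponds to `scaledBasis`. -/
noncomputable def frame (r₁ r₂ : ℝˣ) : Module.Basis (Fin p ⊕ Fin q ⊕ Unit) ℝ V :=
  (scaledBasis p q r₁ r₂).map C.Φ.symm.toLinearEquiv

@[simp]
theorem Φ_frame (r₁ r₂ : ℝˣ) (k) : C.Φ (C.frame r₁ r₂ k) = scaledBasis p q r₁ r₂ k := by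
  simp [frame]

theorem orthonormal_frame (hx : DifferentiableAt ℝ x s) (hy : DifferentiableAt ℝ y s)
    (hxy : deriv x s ^ 2 + deriv y s ^ 2 = 1) {r₁ r₂ : ℝˣ} (h₁ : Fin p → r₁ * x s = 1)
    (h₂ : Fin q → r₂ * y s = 1) :
    Orthonormal ℝ fun k => fderiv ℝ (R x y ∘ (extChartAt I m).symm) (extChartAt I m m)
      (C.frame r₁ r₂ k) := by
  rw [orthonormal_iff_ite]
  intro k l
  rw [C.fderiv_eq hx hy, C.fderiv_eq hx hy, C.inner_toLp]
  simp only [C.Φ_frame]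
  have hb : ∀ {n : ℕ} (i j : Fin n), inner ℝ (EuclideanSpace.basisFun (Fin n) ℝ i)
      (EuclideanSpace.basisFun (Fin n) ℝ j) = if i = j then (1 : ℝ) else 0 := fun i j =>
    orthonormal_iff_ite.1 (EuclideanSpace.basisFun _ ℝ).orthonormal i j
  rcases k with i | i | i <;> rcases l with j | j | j <;>
    simp only [scaledBasis_inl, scaledBasis_inr_inl, scaledBasis_inr_inr, inner_zero_left,
      inner_zero_right, real_inner_smul_left, real_inner_smul_right, hb, Sum.inl.injEq,
      Sum.inr.injEq, reduceCtorEq, if_false, mul_zero, zero_mul, add_zero, zero_add]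
  · split_ifs
    · linear_combination (r₁ * x s + 1) * h₁ i
    · ring
  · split_ifs
    · linear_combination (r₂ * y s + 1) * h₂ i
    · ring
  · rw [if_true]
    linear_combination hxy

/-- The trace of the second covariant derivative of `R a b` for the metric induced by `R x y`. -/
theorem traceSecondDerivative_eq [FiniteDimensional ℝ V] (hx : ContDiffAt ℝ 2 x s)
    (hy : ContDiffAt ℝ 2 y s) (ha : ContDiffAt ℝ 2 a s) (hb : ContDiffAt ℝ 2 b s)
    (hxy : deriv x s ^ 2 + deriv y s ^ 2 = 1)
    (hxy' : deriv x s * deriv (deriv x) s + deriv y s * deriv (deriv y) s = 0)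
    (hx0 : x s ≠ 0) (hy0 : Fin q → y s ≠ 0) :
    traceSecondDerivative I (R x y) (R a b) m = WithLp.toLp 2
      ((deriv (deriv a) s + (p * (deriv x s / x s) + q * (deriv y s / y s)) * deriv a s -
          p * (a s / x s ^ 2)) • C.σ₁ 0,
        (deriv (deriv b) s + (p * (deriv x s / x s) + q * (deriv y s / y s)) * deriv b s -
          q * (b s / y s ^ 2)) • C.σ₂ 0) := by
  obtain ⟨r₁, hr₁⟩ : ∃ r : ℝˣ, (r : ℝ) = (x s)⁻¹ := ⟨(Units.mk0 _ hx0)⁻¹, by simp⟩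
  -- If `y s = 0` then q = 0 and there is nothing to scale, so the value 1 is arbitrary.
  obtain ⟨r₂, hr₂⟩ : ∃ r : ℝˣ, Fin q → (r : ℝ) = (y s)⁻¹ := by
    by_cases h : y s = 0
    · exact ⟨1, fun i => absurd h (hy0 i)⟩
    · exact ⟨(Units.mk0 _ h)⁻¹, fun _ => by simp⟩
  have hxd := hx.differentiableAt (by norm_num : (2 : WithTop ℕ∞) ≠ 0)
  have hyd := hy.differentiableAt (by norm_num : (2 : WithTop ℕ∞) ≠ 0)
  have had := ha.differentiableAt (by norm_num : (2 : WithTop ℕ∞) ≠ 0)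
  have hbd := hb.differentiableAt (by norm_num : (2 : WithTop ℕ∞) ≠ 0)
  have he := C.orthonormal_frame (r₁ := r₁) (r₂ := r₂) hxd hyd hxy
    (fun _ => by rw [hr₁, inv_mul_cancel₀ hx0])
    (fun i => by rw [hr₂ i, inv_mul_cancel₀ (hy0 i)])
  have hnorm : ∀ {n : ℕ} (r : ℝ) (i : Fin n), ‖r • EuclideanSpace.basisFun (Fin n) ℝ i‖ ^ 2 =
      r ^ 2 := fun r i => by
    rw [norm_smul, (EuclideanSpace.basisFun _ ℝ).orthonormal.1 i]
    simp
  have hq : ∀ c : ℝ, (q : ℝ) * (c * (r₂ : ℝ) ^ 2) = q * (c / y s ^ 2) := fun c => by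
    rcases Nat.eq_zero_or_pos q with h | h
    · simp [h]
    · rw [hr₂ ⟨0, h⟩]
      field_simp
  -- Stated for general profiles because it is needed for both `R x y` and `R a b`.
  have hH : ∀ {c d : ℝ → ℝ}, ContDiffAt ℝ 2 c s → ContDiffAt ℝ 2 d s →
      ∑ k, fderiv ℝ (fderiv ℝ (R c d ∘ (extChartAt I m).symm)) (extChartAt I m m)
        (C.frame r₁ r₂ k) (C.frame r₁ r₂ k) = WithLp.toLp 2
        ((deriv (deriv c) s - p * (c s / x s ^ 2)) • C.σ₁ 0,
          (deriv (deriv d) s - q * (d s / y s ^ 2)) • C.σ₂ 0) := fun {c d} hc hd => by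
    simp only [C.fderiv_fderiv_eq hc hd, C.Φ_frame, Fintype.sum_sum_type, scaledBasis_inl,
      scaledBasis_inr_inl, scaledBasis_inr_inr,
      fderiv_fderiv_rotationMap_fst C.jet₁ C.jet₂ hc hd,
      fderiv_fderiv_rotationMap_snd C.jet₁ C.jet₂ hc hd,
      fderiv_fderiv_rotationMap_profile C.jet₁ C.jet₂ hc hd, hnorm, Finset.sum_const,
      Finset.card_univ, Fintype.card_fin, Fintype.card_unit, one_smul]
    rw [← hq, hr₁]
    simp only [← WithLp.toLp_smul, ← WithLp.toLp_add, Prod.smul_mk, Prod.mk_add_mk, smul_zero,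
      zero_add]
    congr 2
    · match_scalars
      field_simp
      ring
    · match_scalars
      ring
  -- The summed second derivative is radial in each factor, hence orthogonal to all sphere
  -- directions. Only ∂ₛ contributes, and there x'x'' + y'y'' = 0.
  have hT : ∑ k, inner ℝ (WithLp.toLp 2
        ((deriv (deriv x) s - p * (x s / x s ^ 2)) • C.σ₁ 0,
          (deriv (deriv y) s - q * (y s / y s ^ 2)) • C.σ₂ 0))
        (fderiv ℝ (R x y ∘ (extChartAt I m).symm) (extChartAt I m m) (C.frame r₁ r₂ k)) •
        fderiv ℝ (R a b ∘ (extChartAt I m).symm) (extChartAt I m m) (C.frame r₁ r₂ k) =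
      (-(p * (deriv x s / x s) + q * (deriv y s / y s))) •
        WithLp.toLp 2 (deriv a s • C.σ₁ 0, deriv b s • C.σ₂ 0) := by
    have hin : ∀ (d f c' d' e' f' : ℝ) (X' : EuclideanSpace ℝ (Fin p))
        (Y' : EuclideanSpace ℝ (Fin q)),
        inner ℝ (WithLp.toLp 2 (d • C.σ₁ 0, f • C.σ₂ 0))
          (WithLp.toLp 2 (c' • fderiv ℝ C.σ₁ 0 X' + d' • C.σ₁ 0,
            e' • fderiv ℝ C.σ₂ 0 Y' + f' • C.σ₂ 0)) = d * d' + f * f' :=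
      fun d f c' d' e' f' X' Y' => by
        simpa using C.inner_toLp 0 d c' d' 0 f e' f' 0 X' 0 Y'
    simp only [C.fderiv_eq hxd hyd, C.fderiv_eq had hbd, hin, C.Φ_frame, Fintype.sum_sum_type,
      scaledBasis_inl, scaledBasis_inr_inl, scaledBasis_inr_inr, zero_mul, mul_zero, add_zero,
      zero_smul, Finset.sum_const_zero, zero_add, map_zero, smul_zero, one_mul]
    simp only [Finset.univ_unique, Finset.sum_const, Finset.card_singleton, one_smul]
    congr 1
    have e1 : (p : ℝ) * (x s / x s ^ 2) * deriv x s = p * (deriv x s / x s) := by field_simp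
    have e2 : (q : ℝ) * (y s / y s ^ 2) * deriv y s = q * (deriv y s / y s) := by
      rcases eq_or_ne (y s) 0 with h | h
      · simp [h]
      · field_simp
    linear_combination hxy' - e1 - e2
  unfold traceSecondDerivative
  rw [traceHessian_metricMatrix _ (C.frame r₁ r₂) (C.contDiffAt hx hy) (C.contDiffAt ha hb) he,
    hH hx hy, hH ha hb, hT]
  simp only [← WithLp.toLp_smul, ← WithLp.toLp_sub, Prod.smul_mk, Prod.mk_sub_mk]
  congr 2 <;> module

end RotationChart
end RotationChart

/-! ### Derivatives along the profile curve. -/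

namespace IsProfile

variable {J : TopologicalSpace.Opens ℝ} {x y α : ℝ → ℝ} (h : IsProfile J x y α) {s : ℝ}
include h

theorem contDiffAt_x (hs : s ∈ J) : ContDiffAt ℝ ∞ x s :=
  h.smooth_x.contDiffAt (J.isOpen.mem_nhds hs)

theorem contDiffAt_y (hs : s ∈ J) : ContDiffAt ℝ ∞ y s :=
  h.smooth_y.contDiffAt (J.isOpen.mem_nhds hs)

theorem contDiffAt_angle (hs : s ∈ J) : ContDiffAt ℝ ∞ α s :=
  h.smooth_angle.contDiffAt (J.isOpen.mem_nhds hs)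

theorem contDiffAt_deriv_angle (hs : s ∈ J) : ContDiffAt ℝ ∞ (deriv α) s :=
  (h.contDiffAt_angle hs).derivWithin (by simp)

theorem hasDerivAt_x (hs : s ∈ J) : HasDerivAt x (Real.cos (α s)) s := by
  rw [← h.cos_angle s hs]
  exact ((h.contDiffAt_x hs).differentiableAt (by simp)).hasDerivAt

theorem hasDerivAt_y (hs : s ∈ J) : HasDerivAt y (Real.sin (α s)) s := by
  rw [← h.sin_angle s hs]
  exact ((h.contDiffAt_y hs).differentiableAt (by simp)).hasDerivAt

theorem hasDerivAt_angle (hs : s ∈ J) : HasDerivAt α (deriv α s) s :=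
  ((h.contDiffAt_angle hs).differentiableAt (by simp)).hasDerivAt

theorem hasDerivAt_deriv_x (hs : s ∈ J) :
    HasDerivAt (deriv x) (-Real.sin (α s) * deriv α s) s :=
  (h.hasDerivAt_angle hs).cos.congr_of_eventuallyEq
    (Filter.eventuallyEq_of_mem (J.isOpen.mem_nhds hs) h.cos_angle)

theorem hasDerivAt_deriv_y (hs : s ∈ J) :
    HasDerivAt (deriv y) (Real.cos (α s) * deriv α s) s :=
  (h.hasDerivAt_angle hs).sin.congr_of_eventuallyEq
    (Filter.eventuallyEq_of_mem (J.isOpen.mem_nhds hs) h.sin_angle)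

variable {p q : ℕ} (hx : ∀ s ∈ J, x s ≠ 0) (hy : ∀ s ∈ J, Fin q → y s ≠ 0)
include hx hy

theorem contDiffAt_meanCurv (hs : s ∈ J) : ContDiffAt ℝ ∞ (meanCurv p q x y α) s := by
  have h1 : ContDiffAt ℝ ∞ (fun s => deriv α s + p * (Real.sin (α s) / x s)) s :=
    (h.contDiffAt_deriv_angle hs).add (contDiffAt_const.mul
      ((h.contDiffAt_angle hs).sin.div (h.contDiffAt_x hs) (hx s hs)))
  refine ContDiffAt.sub h1 ?_
  rcases Nat.eq_zero_or_pos q with hq | hq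
  -- For q = 0 the last term is identically zero, whether or not `y` vanishes.
  · simpa [hq] using contDiffAt_const
  · exact contDiffAt_const.mul
      ((h.contDiffAt_angle hs).cos.div (h.contDiffAt_y hs) (hy s hs ⟨0, hq⟩))

/-- This relation eliminates α'' from the bitension field in favour of f'. -/
theorem deriv_meanCurv (hs : s ∈ J) : deriv (meanCurv p q x y α) s = deriv (deriv α) s +
    p * (Real.cos (α s) * deriv α s / x s - Real.sin (α s) * Real.cos (α s) / x s ^ 2) +
    q * (Real.sin (α s) * deriv α s / y s + Real.sin (α s) * Real.cos (α s) / y s ^ 2) := by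
  have hx0 := hx s hs
  have h1 : HasDerivAt (fun s => deriv α s + p * (Real.sin (α s) / x s)) (deriv (deriv α) s +
      p * (Real.cos (α s) * deriv α s / x s - Real.sin (α s) * Real.cos (α s) / x s ^ 2)) s := by
    refine (((h.contDiffAt_deriv_angle hs).differentiableAt (by simp)).hasDerivAt.add
      (((h.hasDerivAt_angle hs).sin.div (h.hasDerivAt_x hs) hx0).const_mul _)).congr_deriv ?_
    field_simp
  have h2 : HasDerivAt (fun s => q * (Real.cos (α s) / y s)) (-(q *
      (Real.sin (α s) * deriv α s / y s + Real.sin (α s) * Real.cos (α s) / y s ^ 2))) s := by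
    rcases Nat.eq_zero_or_pos q with hq | hq
    · simpa [hq] using hasDerivAt_const s (0 : ℝ)
    · have hy0 := hy s hs ⟨0, hq⟩
      refine (((h.hasDerivAt_angle hs).cos.div (h.hasDerivAt_y hs) hy0).const_mul _).congr_deriv ?_
      field_simp
      ring
  refine ((h1.sub h2).congr_deriv ?_).deriv
  ring

theorem deriv_deriv_meanCurv_mul_sin (hs : s ∈ J) :
    deriv (deriv fun s => -(meanCurv p q x y α s * Real.sin (α s))) s =
      -(deriv (deriv (meanCurv p q x y α)) s * Real.sin (α s) +
        2 * deriv (meanCurv p q x y α) s * (Real.cos (α s) * deriv α s) +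
        meanCurv p q x y α s *
          (Real.cos (α s) * deriv (deriv α) s - Real.sin (α s) * deriv α s ^ 2)) := by
  have hf : ∀ s ∈ J, HasDerivAt (meanCurv p q x y α) (deriv (meanCurv p q x y α) s) s :=
    fun s hs => ((h.contDiffAt_meanCurv hx hy hs).differentiableAt (by simp)).hasDerivAt
  have h1 : deriv (fun s => -(meanCurv p q x y α s * Real.sin (α s))) =ᶠ[nhds s] fun s =>
      -(deriv (meanCurv p q x y α) s * Real.sin (α s) +
        meanCurv p q x y α s * (Real.cos (α s) * deriv α s)) := by
    filter_upwards [J.isOpen.mem_nhds hs] with t ht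
    exact ((hf t ht).mul (h.hasDerivAt_angle ht).sin).neg.deriv
  have hf' := (((h.contDiffAt_meanCurv (p := p) hx hy hs).derivWithin (m := ∞)
    (by simp)).differentiableAt (by simp)).hasDerivAt
  have hα' := ((h.contDiffAt_deriv_angle hs).differentiableAt (by simp)).hasDerivAt
  have hα := h.hasDerivAt_angle hs
  rw [h1.deriv_eq]
  refine (((hf'.mul hα.sin).add ((hf s hs).mul (hα.cos.mul hα'))).neg.congr_deriv ?_).deriv
  simp only [Pi.mul_apply]
  ring

theorem deriv_deriv_meanCurv_mul_cos (hs : s ∈ J) :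
    deriv (deriv fun s => meanCurv p q x y α s * Real.cos (α s)) s =
      deriv (deriv (meanCurv p q x y α)) s * Real.cos (α s) -
        2 * deriv (meanCurv p q x y α) s * (Real.sin (α s) * deriv α s) -
        meanCurv p q x y α s *
          (Real.sin (α s) * deriv (deriv α) s + Real.cos (α s) * deriv α s ^ 2) := by
  have hf : ∀ s ∈ J, HasDerivAt (meanCurv p q x y α) (deriv (meanCurv p q x y α) s) s :=
    fun s hs => ((h.contDiffAt_meanCurv hx hy hs).differentiableAt (by simp)).hasDerivAt
  have h1 : deriv (fun s => meanCurv p q x y α s * Real.cos (α s)) =ᶠ[nhds s] fun s =>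
      deriv (meanCurv p q x y α) s * Real.cos (α s) +
        meanCurv p q x y α s * (-Real.sin (α s) * deriv α s) := by
    filter_upwards [J.isOpen.mem_nhds hs] with t ht
    exact ((hf t ht).mul (h.hasDerivAt_angle ht).cos).deriv
  have hf' := (((h.contDiffAt_meanCurv (p := p) hx hy hs).derivWithin (m := ∞)
    (by simp)).differentiableAt (by simp)).hasDerivAt
  have hα' := ((h.contDiffAt_deriv_angle hs).differentiableAt (by simp)).hasDerivAt
  have hα := h.hasDerivAt_angle hs
  rw [h1.deriv_eq]
  refine (((hf'.mul hα.cos).add ((hf s hs).mul (hα.sin.neg.mul hα'))).congr_deriv ?_).deriv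
  simp only [Pi.mul_apply, Pi.neg_apply]
  ring

end IsProfile

/-! ### Orthogonal projections and diagonal matrices. -/

section Projection

variable {E : Type*} [NormedAddCommGroup E] [InnerProductSpace ℝ E] (K : Submodule ℝ E)
  [K.HasOrthogonalProjection] {u v : E}

theorem starProjection_smul_add_smul (hu : u ∈ K) (hv : v ∈ Kᗮ) (a b : ℝ) :
    K.starProjection (a • u + b • v) = a • u := by
  rw [map_add, map_smul, map_smul, Submodule.starProjection_eq_self_iff.2 hu,
    (Submodule.starProjection_apply_eq_zero_iff K).2 hv, smul_zero, add_zero]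

theorem starProjection_orthogonal_smul_add_smul (hu : u ∈ K) (hv : v ∈ Kᗮ) (a b : ℝ) :
    Kᗮ.starProjection (a • u + b • v) = b • v := by
  rw [add_comm]
  exact starProjection_smul_add_smul Kᗮ hv (K.le_orthogonal_orthogonal hu) b a

theorem toMatrix_eq_diagonal {V κ : Type*} [AddCommGroup V] [Module ℝ V] [Fintype κ]
    [DecidableEq κ] (e : Module.Basis κ ℝ V) {A : V →ₗ[ℝ] V} {d : κ → ℝ}
    (h : ∀ k, A (e k) = d k • e k) : LinearMap.toMatrix e e A = Matrix.diagonal d := by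
  ext i j
  rw [LinearMap.toMatrix_apply, h, map_smul, Finsupp.smul_apply, e.repr_self,
    Matrix.diagonal_apply, Finsupp.single_apply]
  rcases eq_or_ne i j with rfl | hij
  · simp
  · simp [hij, hij.symm]

end Projection

theorem two_le_infty : (2 : WithTop ℕ∞) ≤ ∞ :=
  WithTop.coe_le_coe.2 (le_top : (2 : ℕ∞) ≤ ⊤)

/-! ### Geometry of the immersions: normal, shape operator, tension, bitension. -/

section Rotation

variable {V : Type*} [NormedAddCommGroup V] [NormedSpace ℝ V]
  {H : Type*} [TopologicalSpace H] {I : ModelWithCorners ℝ V H}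
  {M : Type*} [TopologicalSpace M] [ChartedSpace H M]
  {E₁ E₂ : Type*} [NormedAddCommGroup E₁] [InnerProductSpace ℝ E₁]
  [NormedAddCommGroup E₂] [InnerProductSpace ℝ E₂]
  {p q : ℕ} {R : (ℝ → ℝ) → (ℝ → ℝ) → M → WithLp 2 (E₁ × E₂)}
  {J : TopologicalSpace.Opens ℝ} {x y α : ℝ → ℝ}

namespace RotationChart

section Pointwise

variable {m : M} {s : ℝ} (C : RotationChart I p q R m s) (hs : s ∈ J) (h : IsProfile J x y α)
include C h hs

variable [I.Boundaryless]

theorem mvfderiv_immersion (X : V) :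
    mvfderiv I (R x y) m X = WithLp.toLp 2
      (x s • fderiv ℝ C.σ₁ 0 (C.Φ X).1 + ((C.Φ X).2.2 * Real.cos (α s)) • C.σ₁ 0,
        y s • fderiv ℝ C.σ₂ 0 (C.Φ X).2.1 + ((C.Φ X).2.2 * Real.sin (α s)) • C.σ₂ 0) := by
  have hd := C.mvfderiv_eq (h.hasDerivAt_x hs).differentiableAt (h.hasDerivAt_y hs).differentiableAt
    X
  rw [h.cos_angle s hs, h.sin_angle s hs] at hd
  exact hd

theorem mvfderiv_normal (X : V) :
    mvfderiv I (R (fun s => -deriv y s) (deriv x)) m X = WithLp.toLp 2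
      (-Real.sin (α s) • fderiv ℝ C.σ₁ 0 (C.Φ X).1 +
          ((C.Φ X).2.2 * -(Real.cos (α s) * deriv α s)) • C.σ₁ 0,
        Real.cos (α s) • fderiv ℝ C.σ₂ 0 (C.Φ X).2.1 +
          ((C.Φ X).2.2 * (-Real.sin (α s) * deriv α s)) • C.σ₂ 0) := by
  have hx := h.hasDerivAt_deriv_x hs
  have hy : HasDerivAt (fun s => -deriv y s) _ s := (h.hasDerivAt_deriv_y hs).neg
  have hd := C.mvfderiv_eq hy.differentiableAt hx.differentiableAt X
  rw [hx.deriv, hy.deriv, h.cos_angle s hs, h.sin_angle s hs] at hd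
  exact hd

theorem isUnitNormalAt : IsUnitNormalAt I (R x y) (R (fun s => -deriv y s) (deriv x)) m := by
  have hη : R (fun s => -deriv y s) (deriv x) m = WithLp.toLp 2
      ((0 : ℝ) • fderiv ℝ C.σ₁ 0 0 + -Real.sin (α s) • C.σ₁ 0,
        (0 : ℝ) • fderiv ℝ C.σ₂ 0 0 + Real.cos (α s) • C.σ₂ 0) := by
    rw [C.apply_center, h.cos_angle s hs, h.sin_angle s hs]
    simp
  constructor
  · rw [← sq_eq_sq₀ (norm_nonneg _) zero_le_one, ← real_inner_self_eq_norm_sq, hη, C.inner_toLp]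
    linear_combination Real.sin_sq_add_cos_sq (α s)
  · intro X
    have hX := C.mvfderiv_immersion hs h X
    rw [hη]
    refine (congrArg (inner ℝ _) hX).trans ?_
    rw [C.inner_toLp]
    simp only [inner_zero_left]
    ring

variable (hx : x s ≠ 0) (hy : Fin q → y s ≠ 0)
include hx hy

theorem injective_mvfderiv : Function.Injective (mvfderiv I (R x y) m) := by
  refine (injective_iff_map_eq_zero (mvfderiv I (R x y) m)).2 fun X hX => ?_
  have h1 := (C.mvfderiv_immersion hs h X).symm.trans hX
  have h2 := C.inner_toLp (x s) ((C.Φ X).2.2 * Real.cos (α s)) (x s)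
    ((C.Φ X).2.2 * Real.cos (α s)) (y s) ((C.Φ X).2.2 * Real.sin (α s)) (y s)
    ((C.Φ X).2.2 * Real.sin (α s)) (C.Φ X).1 (C.Φ X).1 (C.Φ X).2.1 (C.Φ X).2.1
  rw [h1, inner_zero_left, real_inner_self_eq_norm_sq, real_inner_self_eq_norm_sq] at h2
  have h3 : (x s * ‖(C.Φ X).1‖) ^ 2 + (y s * ‖(C.Φ X).2.1‖) ^ 2 + (C.Φ X).2.2 ^ 2 = 0 := by
    linear_combination -h2 - (C.Φ X).2.2 ^ 2 * Real.sin_sq_add_cos_sq (α s)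
  have hA : x s * ‖(C.Φ X).1‖ = 0 := by
    nlinarith [sq_nonneg (x s * ‖(C.Φ X).1‖), sq_nonneg (y s * ‖(C.Φ X).2.1‖),
      sq_nonneg (C.Φ X).2.2]
  have hB : y s * ‖(C.Φ X).2.1‖ = 0 := by
    nlinarith [sq_nonneg (x s * ‖(C.Φ X).1‖), sq_nonneg (y s * ‖(C.Φ X).2.1‖),
      sq_nonneg (C.Φ X).2.2]
  have hC : (C.Φ X).2.2 = 0 := by
    nlinarith [sq_nonneg (x s * ‖(C.Φ X).1‖), sq_nonneg (y s * ‖(C.Φ X).2.1‖),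
      sq_nonneg (C.Φ X).2.2]
  -- Comparing coordinates supplies an index `j : Fin q`, which is what `hy` needs; without one the
  -- vector is trivially zero.
  have hB' : (C.Φ X).2.1 = 0 := by
    ext j
    rw [norm_eq_zero.1 ((mul_eq_zero.1 hB).resolve_left (hy j))]
  have hA' : (C.Φ X).1 = 0 := norm_eq_zero.1 ((mul_eq_zero.1 hA).resolve_left hx)
  exact (map_eq_zero_iff C.Φ C.Φ.injective).1 (Prod.ext hA' (Prod.ext hB' hC))

/-- The right-hand formula satisfies Weingarten's equation by comparison of dη with dφ, and
injectivity of dφ makes it the only solution. -/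
theorem isShapeOperatorAt_iff (A : TangentSpace I m →ₗ[ℝ] TangentSpace I m) :
    IsShapeOperatorAt I (R x y) (R (fun s => -deriv y s) (deriv x)) m A ↔
      ∀ X : V, C.Φ (A X) = ((deriv y s / x s) • (C.Φ X).1, (-(deriv x s / y s)) • (C.Φ X).2.1,
        deriv α s * (C.Φ X).2.2) := by
  have key : ∀ X : V, mvfderiv I (R (fun s => -deriv y s) (deriv x)) m X =
      -mvfderiv I (R x y) m (C.Φ.symm ((deriv y s / x s) • (C.Φ X).1,
        (-(deriv x s / y s)) • (C.Φ X).2.1, deriv α s * (C.Φ X).2.2)) := fun X => by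
    refine (C.mvfderiv_normal hs h X).trans ?_
    refine Eq.trans ?_ (congrArg Neg.neg (C.mvfderiv_immersion hs h _)).symm
    rw [ContinuousLinearEquiv.apply_symm_apply, ← WithLp.toLp_neg, Prod.neg_mk, h.cos_angle s hs,
      h.sin_angle s hs]
    -- The cancellation of `y s` is legitimate for q > 0; for q = 0 the vector it multiplies is
    -- zero.
    have hY : Real.cos (α s) • fderiv ℝ C.σ₂ 0 (C.Φ X).2.1 =
        (y s * (Real.cos (α s) / y s)) • fderiv ℝ C.σ₂ 0 (C.Φ X).2.1 := by
      rcases Nat.eq_zero_or_pos q with hq | hq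
      · subst hq
        rw [Subsingleton.elim (C.Φ X).2.1 0]
        simp
      · rw [mul_div_cancel₀ _ (hy ⟨0, hq⟩)]
    congr 2
    · simp only [map_smul]
      match_scalars
      · field_simp
      · ring
    · rw [hY]
      simp only [map_smul]
      module
  refine forall_congr' fun X => ?_
  rw [key X, neg_inj]
  refine (C.injective_mvfderiv hs h hx hy).eq_iff.trans ⟨fun e => ?_, fun e => ?_⟩
  · exact (congrArg C.Φ e.symm).trans (C.Φ.apply_symm_apply _)
  · exact (C.Φ.symm_apply_eq).2 e.symm

/-- The scaled coordinate vectors each lie in a single factor, so they are already principal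
directions. -/
theorem exists_orthonormalFrame :
    ∃ e : Module.Basis (Fin p ⊕ Fin q ⊕ Unit) ℝ (TangentSpace I m),
      IsOrthonormalFrameAt I (R x y) m e ∧
      ∀ A : TangentSpace I m →ₗ[ℝ] TangentSpace I m,
        IsShapeOperatorAt I (R x y) (R (fun s => -deriv y s) (deriv x)) m A →
        ∀ k, A (e k) = (Sum.elim (fun _ => deriv y s / x s)
          (Sum.elim (fun _ => -(deriv x s / y s)) (fun _ => deriv α s)) k : ℝ) • e k := by
  obtain ⟨r₁, hr₁⟩ : ∃ r : ℝˣ, (r : ℝ) = (x s)⁻¹ := ⟨(Units.mk0 _ hx)⁻¹, by simp⟩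
  obtain ⟨r₂, hr₂⟩ : ∃ r : ℝˣ, Fin q → (r : ℝ) = (y s)⁻¹ := by
    by_cases h : y s = 0
    · exact ⟨1, fun i => absurd h (hy i)⟩
    · exact ⟨(Units.mk0 _ h)⁻¹, fun _ => by simp⟩
  have hxd := (h.hasDerivAt_x hs).differentiableAt
  have hyd := (h.hasDerivAt_y hs).differentiableAt
  refine ⟨C.frame r₁ r₂, ?_, fun A hA k => ?_⟩
  · have he := C.orthonormal_frame (r₁ := r₁) (r₂ := r₂) hxd hyd (h.arc_length s hs)
      (fun _ => by rw [hr₁, inv_mul_cancel₀ hx]) (fun i => by rw [hr₂ i, inv_mul_cancel₀ (hy i)])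
    have hd : (fun k => mvfderiv I (R x y) m (C.frame r₁ r₂ k)) = _ :=
      funext fun k => (C.mvfderiv_eq hxd hyd _).trans (C.fderiv_eq hxd hyd _).symm
    rw [← hd] at he
    exact he
  · apply C.Φ.injective
    refine ((C.isShapeOperatorAt_iff hs h hx hy A).1 hA _).trans ?_
    refine Eq.trans ?_ (map_smul C.Φ _ _).symm
    have hk := C.Φ_frame r₁ r₂ k
    refine Eq.trans (congrArg (fun Z : _ × (_ × ℝ) => ((deriv y s / x s) • Z.1,
      (-(deriv x s / y s)) • Z.2.1, deriv α s * Z.2.2)) hk) (Eq.trans ?_ (congrArg _ hk.symm))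
    rcases k with i | i | i <;>
      simp [scaledBasis_inl, scaledBasis_inr_inl, scaledBasis_inr_inr]

end Pointwise

section Bitension

variable [FiniteDimensional ℝ V] {t : M → ℝ}
  (C : ∀ m, RotationChart I p q R m (t m)) (ht : ∀ m, t m ∈ J)
  (h : IsProfile J x y α) (hx : ∀ s ∈ J, x s ≠ 0) (hy : ∀ s ∈ J, Fin q → y s ≠ 0)
include C ht h hx hy

/-- This is τ = f η. As an identity of maps on `M` of the form `R a b`, it lets the same trace
formula be applied a second time. -/
theorem tension_eq : tension I (R x y) =
    R (fun s => -(meanCurv p q x y α s * Real.sin (α s)))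
      (fun s => meanCurv p q x y α s * Real.cos (α s)) := by
  funext m
  have hs := ht m
  have hcx := (h.contDiffAt_x hs).of_le two_le_infty
  have hcy := (h.contDiffAt_y hs).of_le two_le_infty
  have hx0 := hx _ hs
  rw [tension, (C m).traceSecondDerivative_eq hcx hcy hcx hcy (h.arc_length _ hs) (by
      rw [(h.hasDerivAt_deriv_x hs).deriv, (h.hasDerivAt_deriv_y hs).deriv, h.cos_angle _ hs,
        h.sin_angle _ hs]
      ring) hx0 (hy _ hs), (C m).apply_center, (h.hasDerivAt_deriv_x hs).deriv,
    (h.hasDerivAt_deriv_y hs).deriv, h.cos_angle _ hs, h.sin_angle _ hs]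
  have hsc := Real.sin_sq_add_cos_sq (α (t m))
  have e1 : x (t m) / x (t m) ^ 2 = 1 / x (t m) := by field_simp
  have e2 : y (t m) / y (t m) ^ 2 = 1 / y (t m) := by
    rcases eq_or_ne (y (t m)) 0 with h0 | h0
    · simp [h0]
    · field_simp
  rw [e1, e2]
  unfold meanCurv
  congr 3
  · linear_combination (p / x (t m)) * hsc
  · linear_combination (q / y (t m)) * hsc

/-- The product rule on f η gives f'' and f' terms. The α'' that remains is removed by
`deriv_meanCurv`, and sin² + cos² = 1 matches the curvature terms. -/
theorem bitension_eq (m : M) : bitension I (R x y) m =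
    (-(deriv (meanCurv p q x y α) (t m) *
      (meanCurv p q x y α (t m) + 2 * deriv α (t m)))) •
      WithLp.toLp 2 (Real.cos (α (t m)) • (C m).σ₁ 0, Real.sin (α (t m)) • (C m).σ₂ 0) +
    (deriv (deriv (meanCurv p q x y α)) (t m)
      + deriv (meanCurv p q x y α) (t m) *
        (p * (deriv x (t m) / x (t m)) + q * (deriv y (t m) / y (t m)))
      - meanCurv p q x y α (t m) *
        (p * (deriv y (t m) / x (t m)) ^ 2 + q * (deriv x (t m) / y (t m)) ^ 2 +
          deriv α (t m) ^ 2)) •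
      WithLp.toLp 2 (-Real.sin (α (t m)) • (C m).σ₁ 0, Real.cos (α (t m)) • (C m).σ₂ 0) := by
  have hs := ht m
  have hcx := (h.contDiffAt_x hs).of_le two_le_infty
  have hcy := (h.contDiffAt_y hs).of_le two_le_infty
  have hf := (h.contDiffAt_meanCurv (p := p) hx hy hs)
  have hα := h.contDiffAt_angle hs
  have hca := (hf.mul hα.sin).neg.of_le two_le_infty
  have hcb := (hf.mul hα.cos).of_le two_le_infty
  have hfd := (hf.differentiableAt (by simp)).hasDerivAt
  have hda : deriv (fun s => -(meanCurv p q x y α s * Real.sin (α s))) (t m) = _ :=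
    (hfd.mul (h.hasDerivAt_angle hs).sin).neg.deriv
  have hdb : deriv (fun s => meanCurv p q x y α s * Real.cos (α s)) (t m) = _ :=
    (hfd.mul (h.hasDerivAt_angle hs).cos).deriv
  rw [bitension, roughLaplacian, neg_neg, tension_eq C ht h hx hy,
    (C m).traceSecondDerivative_eq hcx hcy hca hcb (h.arc_length _ hs) (by
      rw [(h.hasDerivAt_deriv_x hs).deriv, (h.hasDerivAt_deriv_y hs).deriv, h.cos_angle _ hs,
        h.sin_angle _ hs]
      ring) (hx _ hs) (hy _ hs), h.deriv_deriv_meanCurv_mul_sin hx hy hs,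
    h.deriv_deriv_meanCurv_mul_cos hx hy hs, hda, hdb, h.cos_angle _ hs, h.sin_angle _ hs]
  simp only [← WithLp.toLp_smul, ← WithLp.toLp_add, Prod.smul_mk, Prod.mk_add_mk, smul_smul,
    ← add_smul]
  have hsc := Real.sin_sq_add_cos_sq (α (t m))
  have hf' := h.deriv_meanCurv (p := p) (q := q) hx hy hs
  set f := meanCurv p q x y α (t m)
  set f' := deriv (meanCurv p q x y α) (t m)
  set f'' := deriv (deriv (meanCurv p q x y α)) (t m)
  set c := Real.cos (α (t m))
  set σ := Real.sin (α (t m))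
  set β := deriv α (t m)
  set β' := deriv (deriv α) (t m)
  -- With the inverses of x and y treated as free variables the identities are polynomial, so they
  -- also hold where y vanishes.
  simp only [div_eq_mul_inv, mul_pow, inv_pow] at hf' ⊢
  set X := (x (t m))⁻¹
  set Y := (y (t m))⁻¹
  congr 3
  · linear_combination (f * c) * hf' - p * f * σ * X ^ 2 * hsc
  · linear_combination (f * σ) * hf' + q * f * c * Y ^ 2 * hsc

variable [I.Boundaryless]

theorem exists_bitension_eq_smul_add_smul (m : M) :
    ∃ u ∈ LinearMap.range (mvfderiv I (R x y) m).toLinearMap,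
      ∃ v ∈ (LinearMap.range (mvfderiv I (R x y) m).toLinearMap)ᗮ, u ≠ 0 ∧ v ≠ 0 ∧
      bitension I (R x y) m = (-(deriv (meanCurv p q x y α) (t m) *
        (meanCurv p q x y α (t m) + 2 * deriv α (t m)))) • u +
      (deriv (deriv (meanCurv p q x y α)) (t m)
        + deriv (meanCurv p q x y α) (t m) *
          (p * (deriv x (t m) / x (t m)) + q * (deriv y (t m) / y (t m)))
        - meanCurv p q x y α (t m) *
          (p * (deriv y (t m) / x (t m)) ^ 2 + q * (deriv x (t m) / y (t m)) ^ 2 +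
            deriv α (t m) ^ 2)) • v := by
  have hs := ht m
  -- The tangent vector `u` is dφ(∂ₛ), the normal vector `v` is η.
  have hX := (C m).mvfderiv_immersion hs h ((C m).Φ.symm (0, 0, 1))
  have hv := (C m).isUnitNormalAt hs h
  have hη : R (fun s => -deriv y s) (deriv x) m = WithLp.toLp 2
      (-Real.sin (α (t m)) • (C m).σ₁ 0, Real.cos (α (t m)) • (C m).σ₂ 0) := by
    rw [(C m).apply_center, h.cos_angle _ hs, h.sin_angle _ hs]
  have hX' : mvfderiv I (R x y) m ((C m).Φ.symm (0, 0, 1)) = WithLp.toLp 2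
      (Real.cos (α (t m)) • (C m).σ₁ 0, Real.sin (α (t m)) • (C m).σ₂ 0) := by
    refine hX.trans ?_
    simp
  refine ⟨_, ⟨(C m).Φ.symm (0, 0, 1), hX'⟩, _, ?_, ?_, ?_, bitension_eq C ht h hx hy m⟩
  · rw [← hη]
    refine (Submodule.mem_orthogonal _ _).2 ?_
    rintro _ ⟨X, rfl⟩
    exact (real_inner_comm _ _).trans (hv.2 X)
  · rw [← hX']
    intro h0
    have h1 := (C m).injective_mvfderiv hs h (hx _ hs) (hy _ hs)
      (h0.trans (map_zero (mvfderiv I (R x y) m)).symm)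
    have h2 := ((C m).Φ.symm_apply_eq).1 h1
    have h3 : (1 : ℝ) = ((C m).Φ 0).2.2 := congrArg (fun Z => Z.2.2) h2
    simp at h3
  · rw [← hη]
    intro h0
    have h1 := hv.1
    rw [h0, norm_zero] at h1
    exact zero_ne_one h1

variable [FiniteDimensional ℝ (WithLp 2 (E₁ × E₂))]

theorem tangentialPart_bitension_eq_zero_iff (m : M) :
    tangentialPart I (R x y) m (bitension I (R x y) m) = 0 ↔
      deriv (meanCurv p q x y α) (t m) * (meanCurv p q x y α (t m) + 2 * deriv α (t m)) = 0 := by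
  obtain ⟨u, hu, v, hv, hu0, -, hB⟩ := exists_bitension_eq_smul_add_smul C ht h hx hy m
  rw [tangentialPart, hB, starProjection_smul_add_smul _ hu hv, smul_eq_zero_iff_left hu0,
    neg_eq_zero]

theorem normalPart_bitension_eq_zero_iff (m : M) :
    normalPart I (R x y) m (bitension I (R x y) m) = 0 ↔
      deriv (deriv (meanCurv p q x y α)) (t m)
        + deriv (meanCurv p q x y α) (t m) *
          (p * (deriv x (t m) / x (t m)) + q * (deriv y (t m) / y (t m)))
        - meanCurv p q x y α (t m) *
          (p * (deriv y (t m) / x (t m)) ^ 2 + q * (deriv x (t m) / y (t m)) ^ 2 +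
            deriv α (t m) ^ 2) = 0 := by
  obtain ⟨u, hu, v, hv, -, hv0, hB⟩ := exists_bitension_eq_smul_add_smul C ht h hx hy m
  rw [normalPart, hB, starProjection_orthogonal_smul_add_smul _ hu hv, smul_eq_zero_iff_left hv0]

end Bitension
end RotationChart
end Rotation

/-! ### The two families as rotation charts. -/

/-- The chart of `𝕊ᵖ × 𝕊^q × J` at a point, as a chart adapted to `imm`. -/
noncomputable def immChart (p q : ℕ) (J : TopologicalSpace.Opens ℝ) (m : Sph p × Sph q × J) :
    RotationChart (Model p q) p q (imm p q J) m m.2.2 where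
  Φ := ContinuousLinearEquiv.refl ℝ _
  σ₁ := sphereParam m.1
  σ₂ := sphereParam m.2.1
  jet₁ := isSphericalJet_sphereParam m.1
  jet₂ := isSphericalJet_sphereParam m.2.1
  Φ_center := by
    rw [extChartAt_prod, extChartAt_prod]
    exact Prod.ext (extChartAt_sphere_self m.1) (Prod.ext (extChartAt_sphere_self m.2.1) rfl)
  eventuallyEq a b := by
    have h := val_extChartAt_symm_opens J m.2.2
    have hc : Filter.Tendsto (fun ξ : EuclideanSpace ℝ (Fin p) × (EuclideanSpace ℝ (Fin q) × ℝ) =>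
        ξ.2.2) (nhds (extChartAt (Model p q) m m)) (nhds (m.2.2 : ℝ)) := by
      have hξ : (extChartAt (Model p q) m m).2.2 = (m.2.2 : ℝ) := by
        rw [extChartAt_prod, extChartAt_prod]
        rfl
      rw [← hξ]
      exact (continuous_snd.comp continuous_snd).continuousAt
    filter_upwards [hc.eventually h] with ξ hξ
    rw [extChartAt_prod, extChartAt_prod]
    change WithLp.toLp 2 (a ((extChartAt 𝓘(ℝ, ℝ) m.2.2).symm ξ.2.2 : J) • sphereParam m.1 ξ.1,
      b ((extChartAt 𝓘(ℝ, ℝ) m.2.2).symm ξ.2.2 : J) • sphereParam m.2.1 ξ.2.1) = _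
    rw [hξ]
    rfl

/-- The chart of `𝕊ᵖ × J` at a point, as a chart adapted to `immOne`. -/
noncomputable def immOneChart (p : ℕ) (J : TopologicalSpace.Opens ℝ) (m : Sph p × J) :
    RotationChart (ModelOne p) p 0 (immOne p J) m m.2 where
  -- A trivial factor ℝ⁰ is inserted to bring ℝᵖ × ℝ into the common form.
  Φ := (ContinuousLinearEquiv.refl ℝ _).prodCongr
    (ContinuousLinearEquiv.uniqueProd ℝ ℝ (EuclideanSpace ℝ (Fin 0))).symm
  σ₁ := sphereParam m.1
  σ₂ := fun _ => 1
  jet₁ := isSphericalJet_sphereParam m.1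
  jet₂ := isSphericalJet_const
  Φ_center := by
    rw [extChartAt_prod]
    exact Prod.ext (extChartAt_sphere_self m.1) (Prod.ext (Subsingleton.elim _ _) rfl)
  eventuallyEq a b := by
    have h := val_extChartAt_symm_opens J m.2
    have hc : Filter.Tendsto (fun ξ : EuclideanSpace ℝ (Fin p) × ℝ => ξ.2)
        (nhds (extChartAt (ModelOne p) m m)) (nhds (m.2 : ℝ)) := by
      have hξ : (extChartAt (ModelOne p) m m).2 = (m.2 : ℝ) := by
        rw [extChartAt_prod]
        rfl
      rw [← hξ]
      exact continuous_snd.continuousAt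
    filter_upwards [hc.eventually h] with ξ hξ
    rw [extChartAt_prod]
    change WithLp.toLp 2 (a ((extChartAt 𝓘(ℝ, ℝ) m.2).symm ξ.2 : J) • sphereParam m.1 ξ.1,
      b ((extChartAt 𝓘(ℝ, ℝ) m.2).symm ξ.2 : J)) =
      WithLp.toLp 2 (a ξ.2 • sphereParam m.1 ξ.1, b ξ.2 • (1 : ℝ))
    rw [hξ, smul_eq_mul, mul_one]

/-- The equality is limited to `J` because sin α = ẏ is known only there; `J` being open, the
derivatives agree there too. -/
theorem meanCurv_zero_right_eqOn {J : TopologicalSpace.Opens ℝ} {x y α : ℝ → ℝ}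
    (h : IsProfile J x y α) (p : ℕ) : Set.EqOn (meanCurv p 0 x y α) (meanCurvOne p x y α) J :=
  fun s hs => by simp [meanCurv, meanCurvOne, h.sin_angle s hs]

end Biharmonic

/-! ### The main theorem. -/

theorem mainTheorem4 :
    -- the immersions of `𝕊ᵖ × 𝕊^q × J` into `ℝᵖ⁺¹ × ℝ^{q+1}`
    (∀ (p q : ℕ) (J : TopologicalSpace.Opens ℝ) (x y α : ℝ → ℝ),
      IsProfile J x y α → (∀ s ∈ J, 0 < x s) → (∀ s ∈ J, 0 < y s) →
      ∀ (w : Sph p) (z : Sph q) (s : J),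
        -- the map is an immersion with unit normal `η = (-ẏ w, ẋ z)`
        Function.Injective (mvfderiv (Model p q) (imm p q J x y) (w, z, s)) ∧
        IsUnitNormalAt (Model p q) (imm p q J x y) (immNormal p q J x y) (w, z, s) ∧
        -- the shape operator is `ẏ/x` on `T𝕊ᵖ`, `-ẋ/y` on `T𝕊^q` and `α̇` on `∂ₛ`
        (∀ A : TangentSpace (Model p q) (w, z, s) →ₗ[ℝ] TangentSpace (Model p q) (w, z, s),
          IsShapeOperatorAt (Model p q) (imm p q J x y) (immNormal p q J x y) (w, z, s) A ↔
          ∀ (X : EuclideanSpace ℝ (Fin p)) (Y : EuclideanSpace ℝ (Fin q)) (c : ℝ),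
            A (X, Y, c) =
              ((deriv y s / x s) • X, (-(deriv x s / y s)) • Y, deriv α s * c)) ∧
        -- in an orthonormal frame its matrix is diagonal
        (∃ e : Module.Basis (Fin p ⊕ Fin q ⊕ Unit) ℝ (TangentSpace (Model p q) (w, z, s)),
          IsOrthonormalFrameAt (Model p q) (imm p q J x y) (w, z, s) e ∧
          ∀ A : TangentSpace (Model p q) (w, z, s) →ₗ[ℝ] TangentSpace (Model p q) (w, z, s),
            IsShapeOperatorAt (Model p q) (imm p q J x y) (immNormal p q J x y) (w, z, s) A →
            LinearMap.toMatrix e e A = Matrix.diagonal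
              (Sum.elim (fun _ => deriv y s / x s)
                (Sum.elim (fun _ => -(deriv x s / y s)) (fun _ => deriv α s)))) ∧
        -- the tangential and the normal part of the bitension field
        (tangentialPart (Model p q) (imm p q J x y) (w, z, s)
            (bitension (Model p q) (imm p q J x y) (w, z, s)) = 0 ↔
          deriv (meanCurv p q x y α) s * (meanCurv p q x y α s + 2 * deriv α s) = 0) ∧
        (normalPart (Model p q) (imm p q J x y) (w, z, s)
            (bitension (Model p q) (imm p q J x y) (w, z, s)) = 0 ↔
          deriv (deriv (meanCurv p q x y α)) s
            + deriv (meanCurv p q x y α) s * (p * (deriv x s / x s) + q * (deriv y s / y s))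
            - meanCurv p q x y α s *
              (p * (deriv y s / x s) ^ 2 + q * (deriv x s / y s) ^ 2 + deriv α s ^ 2)
            = 0)) ∧
    -- the immersions of `𝕊ᵖ × J` into `ℝᵖ⁺¹ × ℝ`
    (∀ (p : ℕ) (J : TopologicalSpace.Opens ℝ) (x y α : ℝ → ℝ),
      IsProfile J x y α → (∀ s ∈ J, 0 < x s) →
      ∀ (w : Sph p) (s : J),
        Function.Injective (mvfderiv (ModelOne p) (immOne p J x y) (w, s)) ∧
        IsUnitNormalAt (ModelOne p) (immOne p J x y) (immOneNormal p J x y) (w, s) ∧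
        (∀ A : TangentSpace (ModelOne p) (w, s) →ₗ[ℝ] TangentSpace (ModelOne p) (w, s),
          IsShapeOperatorAt (ModelOne p) (immOne p J x y) (immOneNormal p J x y) (w, s) A ↔
          ∀ (X : EuclideanSpace ℝ (Fin p)) (c : ℝ),
            A (X, c) = ((deriv y s / x s) • X, deriv α s * c)) ∧
        (∃ e : Module.Basis (Fin p ⊕ Unit) ℝ (TangentSpace (ModelOne p) (w, s)),
          IsOrthonormalFrameAt (ModelOne p) (immOne p J x y) (w, s) e ∧
          ∀ A : TangentSpace (ModelOne p) (w, s) →ₗ[ℝ] TangentSpace (ModelOne p) (w, s),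
            IsShapeOperatorAt (ModelOne p) (immOne p J x y) (immOneNormal p J x y) (w, s) A →
            LinearMap.toMatrix e e A = Matrix.diagonal
              (Sum.elim (fun _ => deriv y s / x s) (fun _ => deriv α s))) ∧
        (tangentialPart (ModelOne p) (immOne p J x y) (w, s)
            (bitension (ModelOne p) (immOne p J x y) (w, s)) = 0 ↔
          deriv (meanCurvOne p x y α) s * (meanCurvOne p x y α s + 2 * deriv α s) = 0) ∧
        (normalPart (ModelOne p) (immOne p J x y) (w, s)
            (bitension (ModelOne p) (immOne p J x y) (w, s)) = 0 ↔
          deriv (deriv (meanCurvOne p x y α)) s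
            + p * deriv (meanCurvOne p x y α) s * (deriv x s / x s)
            - meanCurvOne p x y α s * (p * (deriv y s / x s) ^ 2 + deriv α s ^ 2) = 0)) := by
  constructor
  · intro p q J x y α h hx hy w z s
    have hx0 : ∀ s ∈ J, x s ≠ 0 := fun s hs => (hx s hs).ne'
    have hy0 : ∀ s ∈ J, Fin q → y s ≠ 0 := fun s hs _ => (hy s hs).ne'
    have ht : ∀ m : Sph p × Sph q × J, (m.2.2 : ℝ) ∈ J := fun m => m.2.2.2
    refine ⟨(immChart p q J (w, z, s)).injective_mvfderiv s.2 h (hx0 s s.2) (hy0 s s.2),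
      (immChart p q J (w, z, s)).isUnitNormalAt s.2 h, fun A => ?_, ?_,
      RotationChart.tangentialPart_bitension_eq_zero_iff (immChart p q J) ht h hx0 hy0 (w, z, s),
      RotationChart.normalPart_bitension_eq_zero_iff (immChart p q J) ht h hx0 hy0 (w, z, s)⟩
    · refine ((immChart p q J (w, z, s)).isShapeOperatorAt_iff s.2 h (hx0 s s.2) (hy0 s s.2)
        A).trans ⟨fun hA X Y c => hA (X, Y, c), fun hA X => hA X.1 X.2.1 X.2.2⟩
    · obtain ⟨e, he, hA⟩ := (immChart p q J (w, z, s)).exists_orthonormalFrame s.2 h (hx0 s s.2)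
        (hy0 s s.2)
      exact ⟨e, he, fun A hs => toMatrix_eq_diagonal e (hA A hs)⟩
  · intro p J x y α h hx w s
    have hx0 : ∀ s ∈ J, x s ≠ 0 := fun s hs => (hx s hs).ne'
    have hy0 : ∀ s ∈ J, Fin 0 → y s ≠ 0 := fun s _ j => j.elim0
    have ht : ∀ m : Sph p × J, (m.2 : ℝ) ∈ J := fun m => m.2.2
    have hf := (meanCurv_zero_right_eqOn h p).eventuallyEq_of_mem (J.isOpen.mem_nhds s.2)
    have hf0 := hf.self_of_nhds
    have hf1 := hf.deriv_eq
    have hf2 := hf.deriv.deriv_eq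
    refine ⟨(immOneChart p J (w, s)).injective_mvfderiv s.2 h (hx0 s s.2) (hy0 s s.2),
      (immOneChart p J (w, s)).isUnitNormalAt s.2 h, fun A => ?_, ?_, ?_, ?_⟩
    · refine ((immOneChart p J (w, s)).isShapeOperatorAt_iff s.2 h (hx0 s s.2) (hy0 s s.2)
        A).trans ⟨fun hA X c => ?_, fun hA X => ?_⟩
      · have hX := hA (X, c)
        have h1 := congrArg (fun Z : EuclideanSpace ℝ (Fin p) × (EuclideanSpace ℝ (Fin 0) × ℝ) => Z.1) hX
        have h2 := congrArg (fun Z : EuclideanSpace ℝ (Fin p) × (EuclideanSpace ℝ (Fin 0) × ℝ) => Z.2.2) hX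
        exact Prod.ext h1 h2
      · have hX := hA X.1 X.2
        have h1 := congrArg (fun Z : EuclideanSpace ℝ (Fin p) × ℝ => Z.1) hX
        have h2 := congrArg (fun Z : EuclideanSpace ℝ (Fin p) × ℝ => Z.2) hX
        exact Prod.ext h1 (Prod.ext (Subsingleton.elim _ _) h2)
    · obtain ⟨e, he, hA⟩ := (immOneChart p J (w, s)).exists_orthonormalFrame s.2 h (hx0 s s.2)
        (hy0 s s.2)
      -- Discards the empty block of indices of the second sphere.
      let E : Fin p ⊕ Fin 0 ⊕ Unit ≃ Fin p ⊕ Unit :=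
        (Equiv.refl _).sumCongr (Equiv.emptySum (Fin 0) Unit)
      refine ⟨e.reindex E, ?_, fun A hs => toMatrix_eq_diagonal _ fun k => ?_⟩
      · have hE := he.comp E.symm E.symm.injective
        simpa [IsOrthonormalFrameAt, Function.comp_def] using hE
      · rw [Module.Basis.reindex_apply, hA A hs]
        rcases k with k | k <;> rfl
    · rw [← hf0, ← hf1]
      exact RotationChart.tangentialPart_bitension_eq_zero_iff (immOneChart p J) ht h hx0 hy0 (w, s)
    · rw [← hf0, ← hf1, ← hf2]
      refine (RotationChart.normalPart_bitension_eq_zero_iff (immOneChart p J) ht h hx0 hy0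
        (w, s)).trans ?_
      refine Eq.congr ?_ rfl
      -- The cast of q = 0 removes every term containing a quotient by `y`.
      push_cast
      ring
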